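/- Consider a radio network given by a connected undirected graph $G=(V,E)$ on $n$ vertices, one device per vertex, in the model with collision detection ($\mathsf{CD}$). Time is divided into synchronous slots and all devices start in the same slot. In each slot a device either sends a message, listens, or idles; sending and listening cost one unit of energy, idling and local computation are free. A device that sends or idles gets no feedback; a device that listens receives the message if exactly one of its neighbors sends, hears silence if no neighbor sends, and hears noise if at least two neighbors send. Devices have distinct IDs in $\{1,\dots,N\}$; initially a device knows only $n$, $N$, its own ID, and whether it is the source. A source vertex $s\in V$ initially holds a message $m$; in the problem $\mathsf{Broadcast}$ every device has to terminate knowing $m$. The time of an execution is the number of slots until all devices have terminated, and its energy is the maximum, over all devices, of the number of slots in which the device sends or listens. **Theorem.** There is a deterministic algorithm that solves $\mathsf{Broadcast}$ in the $\mathsf{CD}$ model in $O(nN^2\log N\log n)$ time with $O(\log^3 N\log n)$ energy. That is, there are an absolute constant $C$ and a deterministic algorithm such that for all $n$ and $N$, every connected graph $G$ on $n$ vertices, every assignment of distinct IDs in $\{1,\dots,N\}$ to the vertices, every source $s$ and every message $m$, the algorithm solves $\mathsf{Broadcast}$ in time at most $C\,nN^2\log N\log n$ with energy at most $C\log^3 N\log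 n$. -/

import Mathlib

namespace Radio

/-- What a device does in one time slot. -/
inductive Action (M : Type) : Type
  | send (msg : M)
  | listen
  | idle

/-- The message put on the channel by an action, if any. -/
def Action.sent {M : Type} : Action M → Option M
  | .send msg => some msg
  | .listen => none
  | .idle => none

/-- The energy spent by an action: sending and listening cost one unit, idling is free. -/
def Action.cost {M : Type} : Action M → ℕ
  | .send _ => 1
  | .listen => 1
  | .idle => 0

/-- What a device learns from the environment in one time slot. A device that does not listen
gets `none`; a listener gets silence, noise, or a message. -/
inductive Feedback (M : Type) : Type
  | none
  | silence
  | noise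
  | message (msg : M)

open Classical in
/-- The channel with collision detection. If device `v` listens while the devices act according
to `act`, then it receives the message if exactly one neighbor of `v` sends, it hears silence if no
neighbor sends, and noise if at least two neighbors send. -/
noncomputable def feedbackCD {V M : Type} (G : SimpleGraph V) (act : V → Action M) (v : V) :
    Feedback M :=
  match act v with
  | .send _ => .none
  | .idle => .none
  | .listen =>
    if h : ∃! u, G.Adj v u ∧ (act u).sent.isSome then
      .message ((act h.choose).sent.get h.choose_spec.1.2)
    else if ∃ u, G.Adj v u ∧ (act u).sent.isSome then .noise
    else .silence

/-- A deterministic algorithm for `Broadcast` with payloads of type `P`, run in identical copies by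
all devices. Initially a device knows the number `n` of vertices, the size `N` of the ID space, its
own ID, and, if it is the source, the payload. In each slot its action depends only on its local
state, which is then updated with the feedback of that slot. A device with
`output state = some p` has terminated with output `p`. Local computation is free. -/
structure Algorithm (P : Type) where
  /-- The messages that devices exchange. -/
  Msg : Type
  /-- The local states of a device. -/
  State : Type
  init : (n N id : ℕ) → (input : Option P) → State
  action : State → Action Msg
  next : State → Feedback Msg → State
  output : State → Option P

namespace Algorithm

variable {P : Type} (A : Algorithm P)

/-- The action of a device in a given state; terminated devices stay idle. -/
def act (q : A.State) : Action A.Msg :=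
  match A.output q with
  | some _ => .idle
  | none => A.action q

/-- The state after one slot; terminated devices keep their state. -/
def step (q : A.State) (f : Feedback A.Msg) : A.State :=
  match A.output q with
  | some _ => q
  | none => A.next q f

open Classical in
/-- The state of every device after `t` slots, when `A` runs on the network `G` in the `CD` model,
with IDs `ID`, source `s` and payload `m`. All devices start in slot zero. -/
noncomputable def run {V : Type} [Fintype V] (N : ℕ) (G : SimpleGraph V) (ID : V → ℕ) (s : V)
    (m : P) : ℕ → V → A.State
  | 0 => fun v => A.init (Fintype.card V) N (ID v) (if v = s then some m else none)
  | t + 1 => fun v =>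
      A.step (run N G ID s m t v) (feedbackCD G (fun u => A.act (run N G ID s m t u)) v)

/-- The energy that device `v` has spent in the first `t` slots. -/
noncomputable def energy {V : Type} [Fintype V] (N : ℕ) (G : SimpleGraph V) (ID : V → ℕ) (s : V)
    (m : P) (t : ℕ) (v : V) : ℕ :=
  ∑ i ∈ Finset.range t, (A.act (A.run N G ID s m i v)).cost

/-- On this instance, within `time` slots all devices have terminated with the payload of the source
as output, and no device ever spends more than `power` units of energy. -/
def BroadcastsWithin {V : Type} [Fintype V] (N : ℕ) (G : SimpleGraph V) (ID : V → ℕ) (s : V)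
    (m : P) (time power : ℝ) : Prop :=
  (∃ t : ℕ, (t : ℝ) ≤ time ∧ ∀ v, A.output (A.run N G ID s m t v) = some m) ∧
    ∀ (t : ℕ) (v : V), (A.energy N G ID s m t v : ℝ) ≤ power

end Algorithm

end Radio

/-! ### Communication rounds: collision-free message passing by tree search -/

namespace Radio

variable {V M : Type}

/-! Communication rounds. Collision detection allows a round in which every listener with a sending
neighbor receives a message from one of them. With `B = Nat.size N`, let slots be the nodes of a
binary tree with leaves `2 ^ B + id`. A sender transmits at all ancestors of its leaf. A listener
descends from the root: silence at a node means that no sending neighbor lies below, noise that at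
least two do, and a single one is heard at once. It probes at most two nodes per level, so a round
takes `O(N)` slots and `O(log N)` energy (`recv_ne_none`, `sum_cost_slotAct`). The rest of the
algorithm is a program of such rounds, executed in lockstep.

Clusters. The devices are partitioned into connected clusters, each layered below a root whose ID
names the cluster. To let a token reach every device of each cluster that holds or neighbors one,
tokens are relayed once along all edges, then swept up to the roots and down again. The schedule
runs through all layers and clusters, `O(nN)` rounds, but a device is active in at most five of them
(`holders_grow`, `rounds_grow`).

Merging. Going through the bits of the cluster IDs, a cluster with bit `j` is dropped if a selected
one without bit `j` is within two steps in the cluster graph. The survivors are pairwise at distance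
at least three (`selected_separated`), and every cluster is within `2 * B` steps of one
(`selected_covers`). If there is more than one cluster, each survivor has a neighboring cluster, not
selected and not shared with another survivor. So letting the survivors absorb everything at least
halves the number of clusters (`Layered.two_mul_card_le`, `exec_merge`). After `Nat.size n` merges
one cluster is left, and one more growth step distributes the payload.

A merge costs each device `O(log N)` rounds, hence the energy is in fact `O(log² N log n)`. -/

theorem feedbackCD_of_ne_listen (G : SimpleGraph V) (act : V → Action M) (v : V)
    (h : act v ≠ .listen) : feedbackCD G act v = .none := by
  unfold feedbackCD
  cases hv : act v <;> simp_all

theorem Action.sent_isSome {a : Action M} : a.sent.isSome ↔ ∃ msg, a = .send msg := by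
  cases a <;> simp [Action.sent]

theorem feedbackCD_of_listen (G : SimpleGraph V) (act : V → Action M) (v : V)
    (h : act v = .listen) :
    (feedbackCD G act v = .silence ∧ ∀ u msg, G.Adj v u → act u ≠ .send msg) ∨
    (∃ u msg, G.Adj v u ∧ act u = .send msg ∧ feedbackCD G act v = .message msg) ∨
    (feedbackCD G act v = .noise ∧ ∃ u w a b, u ≠ w ∧ G.Adj v u ∧ G.Adj v w ∧
      act u = .send a ∧ act w = .send b) := by
  by_cases h1 : ∃! u, G.Adj v u ∧ (act u).sent.isSome
  · right; left
    obtain ⟨msg, hmsg⟩ := Action.sent_isSome.1 h1.choose_spec.1.2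
    refine ⟨h1.choose, msg, h1.choose_spec.1.1, hmsg, ?_⟩
    have key : ∀ hs, (act h1.choose).sent.get hs = msg := by
      rw [hmsg]; intro _; rfl
    simp only [feedbackCD, h, dif_pos h1, key]
  · by_cases h2 : ∃ u, G.Adj v u ∧ (act u).sent.isSome
    · right; right
      refine ⟨by simp only [feedbackCD, h, dif_neg h1, if_pos h2], ?_⟩
      obtain ⟨u, hu, hs⟩ := h2
      have : ∃ w, (G.Adj v w ∧ (act w).sent.isSome) ∧ w ≠ u := by
        by_contra hc
        push Not at hc
        exact h1 ⟨u, ⟨hu, hs⟩, fun w hw => hc w hw⟩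
      obtain ⟨w, ⟨hw, hws⟩, hne⟩ := this
      obtain ⟨a, ha⟩ := Action.sent_isSome.1 hs
      obtain ⟨b, hb⟩ := Action.sent_isSome.1 hws
      exact ⟨u, w, a, b, hne.symm, hu, hw, ha, hb⟩
    · left
      refine ⟨by simp only [feedbackCD, h, dif_neg h1, if_neg h2], ?_⟩
      intro u msg hu hs
      exact h2 ⟨u, hu, Action.sent_isSome.2 ⟨msg, hs⟩⟩

/-- In the binary tree on the positive integers in which `y` has the children `2 * y` and
`2 * y + 1`, the node `y` is an ancestor of `l` (or `l` itself). -/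
def Ancestor (y l : ℕ) : Prop := 0 < y ∧ ∃ k, l / 2 ^ k = y

open Classical in
/-- The action in slot `x` of a device that wants to perform `a` in a communication round. Senders
transmit at all ancestors of their leaf `2 ^ B + id`; a listener with `r = (y, none)` knows that
the subtree of `y` contains a sending neighbor (or `y = 0`), and probes the children of `y`. -/
noncomputable def slotAct (B id : ℕ) (a : Action M) (x : ℕ) (r : ℕ × Option M) : Action M :=
  match a with
  | .send msg => if Ancestor x (2 ^ B + id) then .send msg else .idle
  | .listen => if 0 < x ∧ x / 2 = r.1 ∧ r.2 = none then .listen else .idle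
  | .idle => .idle

/-- The update of a listener after slot `x`. -/
def hear (x : ℕ) (r : ℕ × Option M) : Feedback M → ℕ × Option M
  | .message msg => (x, some msg)
  | .noise => (x, r.2)
  | .silence => r
  | .none => r

/-- The knowledge of all devices after the first slots of a communication round in which the
devices want to perform `act`. -/
noncomputable def scan (G : SimpleGraph V) (ID : V → ℕ) (B : ℕ) (act : V → Action M) :
    ℕ → V → ℕ × Option M
  | 0 => fun _ => (0, none)
  | x + 1 => fun v => hear x (scan G ID B act x v)
      (feedbackCD G (fun u => slotAct B (ID u) (act u) x (scan G ID B act x u)) v)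

/-- The message received in a communication round of `2 ^ (B + 1)` slots. -/
noncomputable def recv (G : SimpleGraph V) (ID : V → ℕ) (B : ℕ) (act : V → Action M) (v : V) :
    Option M :=
  (scan G ID B act (2 ^ (B + 1)) v).2

theorem scan_step (G : SimpleGraph V) (ID : V → ℕ) (B : ℕ) (act : V → Action M) (x : ℕ) (v : V) :
    scan G ID B act (x + 1) v = hear x (scan G ID B act x v)
      (feedbackCD G (fun u => slotAct B (ID u) (act u) x (scan G ID B act x u)) v) := rfl

theorem slotAct_eq_listen {B id x : ℕ} {a : Action M} {r : ℕ × Option M} :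
    slotAct B id a x r = .listen ↔ a = .listen ∧ 0 < x ∧ x / 2 = r.1 ∧ r.2 = none := by
  cases a <;> simp only [slotAct] <;> (try split_ifs) <;> simp_all

theorem slotAct_eq_send {B id x : ℕ} {a : Action M} {r : ℕ × Option M} {msg : M} :
    slotAct B id a x r = .send msg ↔ a = .send msg ∧ Ancestor x (2 ^ B + id) := by
  cases a <;> simp only [slotAct] <;> (try split_ifs) <;> simp_all

theorem cost_slotAct_listen (B id x : ℕ) (r : ℕ × Option M) :
    (slotAct B id .listen x r).cost ≤ 1 := by
  simp only [slotAct]; split_ifs <;> simp [Action.cost]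

/-- One slot of a listener. -/
theorem scan_succ (G : SimpleGraph V) (ID : V → ℕ) (B : ℕ) (act : V → Action M) (v : V) (x : ℕ) :
    (¬ (act v = .listen ∧ 0 < x ∧ x / 2 = (scan G ID B act x v).1 ∧
        (scan G ID B act x v).2 = none) ∧
      scan G ID B act (x + 1) v = scan G ID B act x v) ∨
    ((act v = .listen ∧ 0 < x ∧ x / 2 = (scan G ID B act x v).1 ∧
        (scan G ID B act x v).2 = none) ∧
      ((scan G ID B act (x + 1) v = scan G ID B act x v ∧
          ∀ u msg, G.Adj v u → act u = .send msg → ¬ Ancestor x (2 ^ B + ID u)) ∨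
        (∃ u msg, G.Adj v u ∧ act u = .send msg ∧
          scan G ID B act (x + 1) v = (x, some msg)) ∨
        (scan G ID B act (x + 1) v = (x, none) ∧ ∃ u w a b, u ≠ w ∧ G.Adj v u ∧ G.Adj v w ∧
          act u = .send a ∧ act w = .send b ∧ Ancestor x (2 ^ B + ID u) ∧
          Ancestor x (2 ^ B + ID w)))) := by
  by_cases h : slotAct B (ID v) (act v) x (scan G ID B act x v) = .listen
  · right
    have h0 := slotAct_eq_listen.1 h
    refine ⟨h0, ?_⟩
    rcases feedbackCD_of_listen G
      (fun u => slotAct B (ID u) (act u) x (scan G ID B act x u)) v h with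
      ⟨hf, hs⟩ | ⟨u, msg, hu, hs, hf⟩ | ⟨hf, u, w, a, b, hne, hu, hw, ha, hb⟩
    · left
      refine ⟨by rw [scan_step, hf, hear], fun u msg hu hm hA => hs u msg hu ?_⟩
      exact slotAct_eq_send.2 ⟨hm, hA⟩
    · right; left
      exact ⟨u, msg, hu, (slotAct_eq_send.1 hs).1, by rw [scan_step, hf, hear]⟩
    · right; right
      refine ⟨by rw [scan_step, hf, hear, h0.2.2.2], u, w, a, b, hne, hu, hw, ?_⟩
      have h1 := slotAct_eq_send.1 ha
      have h2 := slotAct_eq_send.1 hb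
      exact ⟨h1.1, h2.1, h1.2, h2.2⟩
  · left
    refine ⟨fun hc => h (slotAct_eq_listen.2 hc), ?_⟩
    rw [scan_step, feedbackCD_of_ne_listen G _ v (by exact h), hear]

theorem scan_some (G : SimpleGraph V) (ID : V → ℕ) (B : ℕ) (act : V → Action M) (v : V) (x : ℕ)
    (msg : M) (h : (scan G ID B act x v).2 = some msg) :
    act v = .listen ∧ ∃ u, G.Adj v u ∧ act u = .send msg := by
  induction x with
  | zero => simp [scan] at h
  | succ x ih =>
    rcases scan_succ G ID B act v x with ⟨_, he⟩ | ⟨h0, ⟨he, _⟩ | ⟨u, m, hu, hm, he⟩ | ⟨he, _⟩⟩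
    · exact ih (he ▸ h)
    · exact ih (he ▸ h)
    · rw [he] at h
      obtain rfl : m = msg := by simpa using h
      exact ⟨h0.1, u, hu, hm⟩
    · simp [he] at h

theorem recv_some {G : SimpleGraph V} {ID : V → ℕ} {B : ℕ} {act : V → Action M} {v : V}
    {msg : M} (h : recv G ID B act v = some msg) :
    act v = .listen ∧ ∃ u, G.Adj v u ∧ act u = .send msg :=
  scan_some G ID B act v _ msg h

theorem Ancestor.child {y l B : ℕ} (h : Ancestor y l) (hl : 2 ^ B ≤ l) (hy : y < 2 ^ B) :
    Ancestor (2 * y) l ∨ Ancestor (2 * y + 1) l := by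
  obtain ⟨h0, k, hk⟩ := h
  cases k with
  | zero => simp at hk; omega
  | succ k =>
    rw [pow_succ, ← Nat.div_div_eq_div_mul] at hk
    rcases Nat.even_or_odd' (l / 2 ^ k) with ⟨c, hc | hc⟩
    · exact .inl ⟨by omega, k, by omega⟩
    · exact .inr ⟨by omega, k, by omega⟩

theorem Ancestor.one {l : ℕ} (hl : 0 < l) : Ancestor 1 l :=
  ⟨one_pos, Nat.log 2 l, by
    have h1 := Nat.pow_log_le_self 2 hl.ne'
    have h2 := Nat.lt_pow_succ_log_self (b := 2) one_lt_two l
    rw [pow_succ] at h2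
    apply Nat.div_eq_of_lt_le <;> omega⟩

theorem Ancestor.eq_of_leaf {y l B : ℕ} (h : Ancestor y l) (hy : 2 ^ B ≤ y)
    (hl : l < 2 ^ (B + 1)) : y = l := by
  obtain ⟨h0, k, rfl⟩ := h
  cases k with
  | zero => simp
  | succ k =>
    exfalso
    have h1 : l / 2 ^ (k + 1) ≤ l / 2 := by
      rw [pow_succ', ← Nat.div_div_eq_div_mul]
      exact Nat.div_le_self _ _
    rw [pow_succ] at hl
    omega

/-- The search descends only into subtrees that contain a sending neighbor, so it can end only with
a message. -/
theorem recv_ne_none {G : SimpleGraph V} {ID : V → ℕ} {B : ℕ} {act : V → Action M} {v u : V}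
    {msg : M} (hID : Function.Injective ID) (hB : ∀ v, ID v < 2 ^ B) (hv : act v = .listen)
    (hu : G.Adj v u) (hm : act u = .send msg) : recv G ID B act v ≠ none := by
  -- Invariant, with `y` the current node: its children are not both passed, and if `y` is not the
  -- initial `0`, a sending neighbor `w` lies below `y`. Once the left child has been passed, `w` is
  -- not below it.
  have key : ∀ x, (scan G ID B act x v).2 ≠ none ∨
      ((scan G ID B act x v).1 < 2 ^ B ∧ x ≤ 2 * (scan G ID B act x v).1 + 1 ∧
        ((scan G ID B act x v).1 ≠ 0 → ∃ w m, G.Adj v w ∧ act w = .send m ∧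
          Ancestor (scan G ID B act x v).1 (2 ^ B + ID w) ∧
          (x = 2 * (scan G ID B act x v).1 + 1 →
            ¬ Ancestor (2 * (scan G ID B act x v).1) (2 ^ B + ID w)))) := by
    intro x
    induction x with
    | zero => right; simp [scan]
    | succ x ih =>
      rcases scan_succ G ID B act v x with
        ⟨h0, he⟩ | ⟨⟨_, h0, hx, hn⟩, ⟨he, hs⟩ | ⟨w, m, hw, hm, he⟩ |
          ⟨he, w, z, a, b, hne, hw, hz, ha, hb, hAw, hAz⟩⟩
      · rw [he]
        rcases ih with h | ⟨h1, h2, h3⟩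
        · exact .inl h
        by_cases hnone : (scan G ID B act x v).2 = none
        · right
          have h4 : ¬ (0 < x ∧ x / 2 = (scan G ID B act x v).1) :=
            fun hc => h0 ⟨hv, hc.1, hc.2, hnone⟩
          refine ⟨h1, by omega, fun h => ?_⟩
          obtain ⟨w, m, hw, hm, hA, hA'⟩ := h3 h
          -- The last condition is vacuous: if the next slot is the right child, the present one is
          -- the left child, which would have been probed.
          exact ⟨w, m, hw, hm, hA, by omega⟩
        · exact .inl hnone
      · rw [he]
        right
        obtain ⟨h1, h2, h3⟩ := ih.resolve_left (by simp [hn])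
        by_cases hz : (scan G ID B act x v).1 = 0
        · exfalso
          have : x = 1 := by omega
          subst this
          exact hs u msg hu hm (Ancestor.one (by positivity))
        · obtain ⟨w, m, hw, hm, hA, hA'⟩ := h3 hz
          -- Silence at the right child as well would leave no place for `w`.
          have h5 : x ≠ 2 * (scan G ID B act x v).1 + 1 := by
            intro hc
            rcases hA.child (Nat.le_add_right _ _) h1 with h | h
            · exact hA' hc h
            · exact hs w m hw hm (hc ▸ h)
          have h6 : x = 2 * (scan G ID B act x v).1 := by omega
          exact ⟨h1, by omega, fun _ => ⟨w, m, hw, hm, hA, fun _ => h6 ▸ hs w m hw hm⟩⟩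
      · left; simp [he]
      · right
        rw [he]
        refine ⟨?_, by dsimp only; omega, fun _ => ⟨w, a, hw, ha, hAw, by dsimp only; omega⟩⟩
        -- Noise at a leaf would require two senders with the same ID.
        by_contra hc
        have hlt : ∀ w, 2 ^ B + ID w < 2 ^ (B + 1) := fun w => by
          have := hB w
          rw [pow_succ]; omega
        have h1 := hAw.eq_of_leaf (not_lt.1 hc) (hlt _)
        have h2 := hAz.eq_of_leaf (not_lt.1 hc) (hlt _)
        exact hne (hID (by omega))
  -- After the last slot, `y < 2 ^ B` and `x ≤ 2 * y + 1` are incompatible.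
  rcases key (2 ^ (B + 1)) with h | ⟨h1, h2, _⟩
  · exact h
  · have := pow_succ 2 B; omega

/-- Energy of a sender: shifts by more than `B` bits give `0`, which is not a node. -/
theorem card_ancestors (B l : ℕ) (hl : l < 2 ^ (B + 1)) (s : Finset ℕ)
    (hs : ∀ x ∈ s, Ancestor x l) : s.card ≤ B + 1 := by
  have : s ⊆ (Finset.range (B + 1)).image (fun k => l / 2 ^ k) := by
    intro x hx
    obtain ⟨h0, k, hk⟩ := hs x hx
    refine Finset.mem_image.2 ⟨k, Finset.mem_range.2 ?_, hk⟩
    by_contra hc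
    have : l < 2 ^ k := hl.trans_le (Nat.pow_le_pow_right two_pos (not_lt.1 hc))
    rw [Nat.div_eq_of_lt this] at hk
    omega
  exact (Finset.card_le_card this).trans (Finset.card_image_le.trans (by simp))

theorem scan_fst_le (G : SimpleGraph V) (ID : V → ℕ) (B : ℕ) (act : V → Action M) (v : V)
    (x : ℕ) : (scan G ID B act x v).1 ≤ x - 1 := by
  induction x with
  | zero => simp [scan]
  | succ x ih =>
    rcases scan_succ G ID B act v x with ⟨_, he⟩ | ⟨h0, ⟨he, _⟩ | ⟨u, m, hu, hm, he⟩ | ⟨he, _⟩⟩ <;>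
      rw [he] <;> omega

/-- Potential argument: two probes are charged to each level already descended, and the `min` term
bounds the probed children of the current node. Moving to a child raises `Nat.size` by one, which
pays for the probes made at the parent. -/
theorem sum_cost_listen (G : SimpleGraph V) (ID : V → ℕ) (B : ℕ) (act : V → Action M) (v : V)
    (hv : act v = .listen) (x : ℕ) :
    ∑ y ∈ Finset.range x, (slotAct B (ID v) (act v) y (scan G ID B act y v)).cost ≤
      2 * Nat.size (scan G ID B act x v).1 + min 2 (x - 2 * (scan G ID B act x v).1) := by
  induction x with
  | zero => simp
  | succ x ih =>
    rw [Finset.sum_range_succ]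
    have hc := cost_slotAct_listen B (ID v) x (scan G ID B act x v)
    rw [hv] at ih ⊢
    have hsize : x / 2 = (scan G ID B act x v).1 → 0 < x →
        Nat.size x = Nat.size (scan G ID B act x v).1 + 1 := by
      intro h h0
      rw [← h]
      conv_lhs => rw [← Nat.bit_bodd_div2 x]
      rw [Nat.size_bit (by rw [Nat.bit_bodd_div2]; omega), Nat.div2_val]
    rcases scan_succ G ID B act v x with
      ⟨h0, he⟩ | ⟨h0, ⟨he, _⟩ | ⟨u, m, hu, hm, he⟩ | ⟨he, _⟩⟩
    · have : (slotAct B (ID v) (.listen : Action M) x (scan G ID B act x v)).cost = 0 := by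
        rw [hv] at h0
        have h1 : ¬ (0 < x ∧ x / 2 = (scan G ID B act x v).1 ∧ (scan G ID B act x v).2 = none) :=
          fun h => h0 ⟨rfl, h⟩
        simp only [slotAct, if_neg h1, Action.cost]
      rw [he, this]
      omega
    · rw [he]
      omega
    · rw [he]
      have := hsize h0.2.2.1 h0.2.1
      dsimp only
      omega
    · rw [he]
      have := hsize h0.2.2.1 h0.2.1
      dsimp only
      omega

/-- A listener's final node has size at most `B + 1`, hence `2 * (B + 1) + 2`. -/
theorem sum_cost_slotAct (G : SimpleGraph V) (ID : V → ℕ) (B : ℕ) (act : V → Action M) (v : V)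
    (hB : ID v < 2 ^ B) :
    ∑ y ∈ Finset.range (2 ^ (B + 1)), (slotAct B (ID v) (act v) y (scan G ID B act y v)).cost ≤
      (2 * B + 4) * (act v).cost := by
  classical
  cases hv : act v with
  | idle => simp [slotAct, Action.cost]
  | listen =>
    have h := sum_cost_listen G ID B act v hv (2 ^ (B + 1))
    have h1 := scan_fst_le G ID B act v (2 ^ (B + 1))
    have h2 : Nat.size (scan G ID B act (2 ^ (B + 1)) v).1 ≤ B + 1 := by
      rw [Nat.size_le]
      have : 0 < 2 ^ (B + 1) := by positivity
      omega
    rw [hv] at h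
    have h3 : (.listen : Action M).cost = 1 := rfl
    rw [h3]
    omega
  | send msg =>
    have h := card_ancestors B (2 ^ B + ID v) (by rw [pow_succ]; omega)
      ((Finset.range (2 ^ (B + 1))).filter fun x => Ancestor x (2 ^ B + ID v)) (by simp)
    rw [Finset.card_filter] at h
    have : ∀ y, (slotAct B (ID v) (.send msg) y (scan G ID B act y v)).cost =
        if Ancestor y (2 ^ B + ID v) then 1 else 0 := by
      intro y
      simp only [slotAct]
      split_ifs <;> rfl
    have h3 : (.send msg : Action M).cost = 1 := rfl
    simp only [this]
    rw [h3]
    omega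

end Radio

/-! ### Programs of communication rounds and their execution as algorithms -/

namespace Radio

variable {V M σ P : Type}

/-- One instruction of a program: a communication round followed by a local computation. -/
structure Instr (σ M : Type) : Type where
  /-- What the device wants to do in the communication round. -/
  role : σ → Action M
  /-- The new state, given the received message. -/
  upd : σ → Option M → σ

/-- The effect of one instruction on the states of all devices. -/
noncomputable def Instr.exec (G : SimpleGraph V) (ID : V → ℕ) (B : ℕ) (i : Instr σ M)
    (st : V → σ) : V → σ :=
  fun v => i.upd (st v) (recv G ID B (fun u => i.role (st u)) v)

/-- The effect of a program on the states of all devices. -/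
noncomputable def exec (G : SimpleGraph V) (ID : V → ℕ) (B : ℕ) :
    List (Instr σ M) → (V → σ) → V → σ
  | [], st => st
  | i :: l, st => exec G ID B l (i.exec G ID B st)

/-- The number of communication rounds of a program in which `v` takes part. -/
noncomputable def rounds (G : SimpleGraph V) (ID : V → ℕ) (B : ℕ) (v : V) :
    List (Instr σ M) → (V → σ) → ℕ
  | [], _ => 0
  | i :: l, st => (i.role (st v)).cost + rounds G ID B v l (i.exec G ID B st)

theorem exec_append (G : SimpleGraph V) (ID : V → ℕ) (B : ℕ) (l l' : List (Instr σ M))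
    (st : V → σ) : exec G ID B (l ++ l') st = exec G ID B l' (exec G ID B l st) := by
  induction l generalizing st with
  | nil => rfl
  | cons i l ih => exact ih _

theorem rounds_append (G : SimpleGraph V) (ID : V → ℕ) (B : ℕ) (v : V) (l l' : List (Instr σ M))
    (st : V → σ) : rounds G ID B v (l ++ l') st =
      rounds G ID B v l st + rounds G ID B v l' (exec G ID B l st) := by
  induction l generalizing st with
  | nil => simp [rounds, exec]
  | cons i l ih => simp only [List.cons_append, rounds, exec, ih, add_assoc]

/-- A device that executes a program. -/
structure Device (σ M : Type) : Type where
  /-- The instructions that are left. -/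
  prog : List (Instr σ M)
  /-- The state of the program. -/
  st : σ
  /-- The slot within the current communication round. -/
  slot : ℕ
  /-- The knowledge acquired in the current communication round. -/
  heard : ℕ × Option M
  /-- The length of the IDs. -/
  B : ℕ
  /-- The ID. -/
  id : ℕ

/-- The behavior of a device that executes a program. -/
noncomputable def Device.action (d : Device σ M) : Action M :=
  match d.prog with
  | [] => .idle
  | i :: _ => slotAct d.B d.id (i.role d.st) d.slot d.heard

/-- The transition of a device that executes a program. -/
def Device.next (d : Device σ M) (f : Feedback M) : Device σ M :=
  match d.prog with
  | [] => d
  | i :: l =>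
    if d.slot + 1 = 2 ^ (d.B + 1) then
      ⟨l, i.upd d.st (hear d.slot d.heard f).2, 0, (0, none), d.B, d.id⟩
    else ⟨i :: l, d.st, d.slot + 1, hear d.slot d.heard f, d.B, d.id⟩

/-- The algorithm that executes a program. -/
noncomputable def compile (prog : ℕ → ℕ → List (Instr σ M)) (init : ℕ → Option P → σ)
    (out : σ → Option P) : Algorithm P where
  Msg := M
  State := Device σ M
  init n N id input := ⟨prog n N, init id input, 0, (0, none), Nat.size N, id⟩
  action := Device.action
  next := Device.next
  output d := match d.prog with
    | [] => out d.st
    | _ :: _ => none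

theorem Algorithm.step_of_output (A : Algorithm P) {q : A.State} {p : P}
    (h : A.output q = some p) (f : Feedback A.Msg) : A.step q f = q := by
  simp [Algorithm.step, h]

theorem Algorithm.act_of_output (A : Algorithm P) {q : A.State} {p : P}
    (h : A.output q = some p) : A.act q = .idle := by
  simp [Algorithm.act, h]

section Run

variable [Fintype V] (prog : ℕ → ℕ → List (Instr σ M)) (init : ℕ → Option P → σ)
  (out : σ → Option P) (N : ℕ) (G : SimpleGraph V) (ID : V → ℕ) (s : V) (m : P)

theorem compile_act (i : Instr σ M) (l : List (Instr σ M)) (st : σ) (x : ℕ) (r : ℕ × Option M)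
    (B id : ℕ) : (compile prog init out).act (⟨i :: l, st, x, r, B, id⟩ : Device σ M) =
      slotAct B id (i.role st) x r := rfl

theorem compile_step (i : Instr σ M) (l : List (Instr σ M)) (st : σ) (x : ℕ) (r : ℕ × Option M)
    (B id : ℕ) (f : Feedback M) :
    (compile prog init out).step (⟨i :: l, st, x, r, B, id⟩ : Device σ M) f =
      (if x + 1 = 2 ^ (B + 1) then ⟨l, i.upd st (hear x r f).2, 0, (0, none), B, id⟩
      else ⟨i :: l, st, x + 1, hear x r f, B, id⟩ : Device σ M) := rfl

theorem run_round (B t : ℕ) (i : Instr σ M) (l : List (Instr σ M)) (st : V → σ)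
    (h : (compile prog init out).run N G ID s m t =
      fun v => (⟨i :: l, st v, 0, (0, none), B, ID v⟩ : Device σ M)) (x : ℕ)
    (hx : x < 2 ^ (B + 1)) :
    (compile prog init out).run N G ID s m (t + x) =
      fun v => (⟨i :: l, st v, x, scan G ID B (fun u => i.role (st u)) x v, B, ID v⟩ :
        Device σ M) := by
  induction x with
  | zero => exact h
  | succ x ih =>
    have ih := ih (by omega)
    rw [← add_assoc]
    funext v
    rw [Algorithm.run, ih]
    simp only [compile_act]
    refine (compile_step ..).trans ?_
    rw [if_neg (by omega)]
    rfl

theorem run_instr (B t : ℕ) (i : Instr σ M) (l : List (Instr σ M)) (st : V → σ)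
    (h : (compile prog init out).run N G ID s m t =
      fun v => (⟨i :: l, st v, 0, (0, none), B, ID v⟩ : Device σ M)) :
    (compile prog init out).run N G ID s m (t + 2 ^ (B + 1)) =
      fun v => (⟨l, i.exec G ID B st v, 0, (0, none), B, ID v⟩ : Device σ M) := by
  have hpos : 0 < 2 ^ (B + 1) := by positivity
  obtain ⟨x, hx⟩ : ∃ x, 2 ^ (B + 1) = x + 1 := ⟨2 ^ (B + 1) - 1, by omega⟩
  have ih := run_round prog init out N G ID s m B t i l st h x (by omega)
  rw [hx, ← add_assoc]
  funext v
  rw [Algorithm.run, ih]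
  simp only [compile_act]
  refine (compile_step ..).trans ?_
  rw [if_pos hx.symm, Instr.exec, recv, hx]
  rfl

theorem energy_instr (B t : ℕ) (i : Instr σ M) (l : List (Instr σ M)) (st : V → σ)
    (h : (compile prog init out).run N G ID s m t =
      fun v => (⟨i :: l, st v, 0, (0, none), B, ID v⟩ : Device σ M)) (v : V)
    (hB : ID v < 2 ^ B) :
    (compile prog init out).energy N G ID s m (t + 2 ^ (B + 1)) v ≤
      (compile prog init out).energy N G ID s m t v + (2 * B + 4) * (i.role (st v)).cost := by
  rw [Algorithm.energy, Finset.sum_range_add]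
  refine Nat.add_le_add_left ?_ _
  refine le_trans (le_of_eq ?_) (sum_cost_slotAct G ID B (fun u => i.role (st u)) v hB)
  refine Finset.sum_congr rfl fun x hx => ?_
  rw [run_round prog init out N G ID s m B t i l st h x (Finset.mem_range.1 hx)]
  rfl

theorem run_prog (B t : ℕ) (l : List (Instr σ M)) (st : V → σ) (hB : ∀ v, ID v < 2 ^ B)
    (h : (compile prog init out).run N G ID s m t =
      fun v => (⟨l, st v, 0, (0, none), B, ID v⟩ : Device σ M)) :
    (compile prog init out).run N G ID s m (t + 2 ^ (B + 1) * l.length) =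
        (fun v => (⟨[], exec G ID B l st v, 0, (0, none), B, ID v⟩ : Device σ M)) ∧
      ∀ v, (compile prog init out).energy N G ID s m (t + 2 ^ (B + 1) * l.length) v ≤
        (compile prog init out).energy N G ID s m t v + (2 * B + 4) * rounds G ID B v l st := by
  induction l generalizing t st with
  | nil => exact ⟨h, fun v => by simp⟩
  | cons i l ih =>
    obtain ⟨h1, h2⟩ := ih _ _ (run_instr prog init out N G ID s m B t i l st h)
    have e : t + 2 ^ (B + 1) * (i :: l).length =
        t + 2 ^ (B + 1) + 2 ^ (B + 1) * l.length := by
      rw [List.length_cons]; ring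
    rw [e]
    refine ⟨h1, fun v => (h2 v).trans ?_⟩
    have := energy_instr prog init out N G ID s m B t i l st h v (hB v)
    rw [rounds, mul_add]
    omega

/-- Time and energy of the algorithm that executes a program. -/
theorem compile_broadcasts {time power : ℝ} {E : ℕ} (hID : ∀ v, ID v ≤ N)
    (hout : ∀ v, out (exec G ID (Nat.size N) (prog (Fintype.card V) N)
      (fun v => open Classical in init (ID v) (if v = s then some m else none)) v) = some m)
    (hE : ∀ v, rounds G ID (Nat.size N) v (prog (Fintype.card V) N)
      (fun v => open Classical in init (ID v) (if v = s then some m else none)) ≤ E)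
    (htime : ((2 ^ (Nat.size N + 1) * (prog (Fintype.card V) N).length : ℕ) : ℝ) ≤ time)
    (hpower : (((2 * Nat.size N + 4) * E : ℕ) : ℝ) ≤ power) :
    (compile prog init out).BroadcastsWithin N G ID s m time power := by
  classical
  have hB : ∀ v, ID v < 2 ^ Nat.size N := fun v => (hID v).trans_lt (Nat.lt_size_self N)
  obtain ⟨h1, h2⟩ := run_prog prog init out N G ID s m (Nat.size N) 0 _ _ hB rfl
  rw [zero_add] at h1 h2
  have hfin : ∀ t v, (compile prog init out).output ((compile prog init out).run N G ID s m
      (2 ^ (Nat.size N + 1) * (prog (Fintype.card V) N).length + t) v) = some m := by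
    intro t
    induction t with
    | zero => intro v; rw [add_zero, h1]; exact hout v
    | succ t ih =>
      intro v
      exact (congrArg _ (Algorithm.step_of_output _ (ih v) _)).trans (ih v)
  refine ⟨⟨_, htime, fun v => hfin 0 v⟩, fun t v => le_trans ?_ hpower⟩
  rw [Nat.cast_le]
  -- Energy at time `t` is at most that `t` slots after the end of the program, and nothing is spent
  -- after the end.
  have h3 : (compile prog init out).energy N G ID s m t v ≤ (compile prog init out).energy N G ID
      s m (2 ^ (Nat.size N + 1) * (prog (Fintype.card V) N).length + t) v :=
    Finset.sum_le_sum_of_subset (Finset.range_mono (Nat.le_add_left _ _))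
  have h4 : (compile prog init out).energy N G ID s m
      (2 ^ (Nat.size N + 1) * (prog (Fintype.card V) N).length + t) v =
      (compile prog init out).energy N G ID s m
        (2 ^ (Nat.size N + 1) * (prog (Fintype.card V) N).length) v := by
    rw [Algorithm.energy, Finset.sum_range_add, Algorithm.energy, Nat.add_eq_left]
    refine Finset.sum_eq_zero fun x _ => ?_
    rw [Algorithm.act_of_output _ (hfin x v)]
    rfl
  have h5 := h2 v
  have h6 : (compile prog init out).energy N G ID s m 0 v = 0 := rfl
  rw [h6, zero_add] at h5
  rw [h4] at h3
  exact h3.trans (h5.trans (Nat.mul_le_mul_left _ (hE v)))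

end Run

end Radio

/-! ### Tokens and their propagation in layered clusters -/

namespace Radio

variable {V P : Type}

/-- A token carries a label, consisting of a cluster and a layer, and possibly the payload. -/
structure Token (P : Type) : Type where
  /-- The payload, if any. -/
  pay : Option P
  /-- The cluster. -/
  clu : ℕ
  /-- The layer. -/
  lay : ℕ

/-- The token stored by the receiver of a token. -/
def Token.succ (t : Token P) : Token P := ⟨t.pay, t.clu, t.lay + 1⟩

/-- The local state of the broadcast program. -/
structure Node (P : Type) : Type where
  /-- The cluster of the device. -/
  clu : ℕ
  /-- The layer of the device in its cluster. -/
  lay : ℕ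
  /-- Whether the cluster of the device is still selected. -/
  mem : Bool
  /-- The token of the device, if any. -/
  tok : Option (Token P)
  /-- The payload, if known. -/
  pay : Option P

open Classical in
/-- Devices with a token and with a label in `S` send it; devices without a token and with a label
in `R` listen, and store the token they receive. -/
noncomputable def relay (S R : ℕ → ℕ → Prop) : Instr (Node P) (Token P) where
  role q := match q.tok with
    | some t => if S q.clu q.lay then .send t else .idle
    | none => if R q.clu q.lay then .listen else .idle
  upd q r := match r with
    | some t => { q with tok := some t.succ }
    | none => q

theorem relay_role_listen {S R : ℕ → ℕ → Prop} {q : Node P} :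
    (relay S R).role q = .listen ↔ q.tok = none ∧ R q.clu q.lay := by
  simp only [relay]
  cases h : q.tok <;> simp only <;> split_ifs <;> simp_all

theorem relay_role_send {S R : ℕ → ℕ → Prop} {q : Node P} {t : Token P} :
    (relay S R).role q = .send t ↔ q.tok = some t ∧ S q.clu q.lay := by
  simp only [relay]
  cases h : q.tok <;> simp only <;> split_ifs <;> simp_all

theorem relay_cost {S R : ℕ → ℕ → Prop} {q : Node P} : ((relay S R).role q).cost ≤ 1 := by
  cases (relay S R).role q <;> simp [Action.cost]

theorem relay_cost_eq_zero {S R : ℕ → ℕ → Prop} {q : Node P} (hS : ¬ S q.clu q.lay)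
    (hR : ¬ R q.clu q.lay) : ((relay S R).role q).cost = 0 := by
  simp only [relay]
  cases h : q.tok <;> simp [hS, hR, Action.cost]

/-- `Grows G st st'` says that `st'` arises from `st` by passing on tokens along edges of `G`. -/
structure Grows (G : SimpleGraph V) (st st' : V → Node P) : Prop where
  clu : ∀ v, (st' v).clu = (st v).clu
  lay : ∀ v, (st' v).lay = (st v).lay
  mem : ∀ v, (st' v).mem = (st v).mem
  pay : ∀ v, (st' v).pay = (st v).pay
  tok : ∀ v t, (st v).tok = some t → (st' v).tok = some t
  new : ∀ v t', (st' v).tok = some t' → (st v).tok = some t' ∨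
    ∃ u t, G.Adj v u ∧ (st' u).tok = some t ∧ t' = t.succ

theorem Grows.refl (G : SimpleGraph V) (st : V → Node P) : Grows G st st :=
  ⟨fun _ => rfl, fun _ => rfl, fun _ => rfl, fun _ => rfl, fun _ _ h => h, fun _ _ h => .inl h⟩

theorem Grows.trans {G : SimpleGraph V} {a b c : V → Node P} (h : Grows G a b)
    (h' : Grows G b c) : Grows G a c where
  clu v := (h'.clu v).trans (h.clu v)
  lay v := (h'.lay v).trans (h.lay v)
  mem v := (h'.mem v).trans (h.mem v)
  pay v := (h'.pay v).trans (h.pay v)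
  tok v t ht := h'.tok v t (h.tok v t ht)
  new v t' ht := by
    rcases h'.new v t' ht with h1 | h1
    · rcases h.new v t' h1 with h2 | ⟨u, t, hu, h3, h4⟩
      · exact .inl h2
      · exact .inr ⟨u, t, hu, h'.tok u t h3, h4⟩
    · exact .inr h1

theorem Grows.tok_ne_none {G : SimpleGraph V} {st st' : V → Node P} (h : Grows G st st') {v : V}
    (hv : (st v).tok ≠ none) : (st' v).tok ≠ none := by
  obtain ⟨t, ht⟩ := Option.ne_none_iff_exists'.1 hv
  rw [h.tok v t ht]
  exact Option.some_ne_none t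

section Relay

variable (G : SimpleGraph V) (ID : V → ℕ) (B : ℕ)

theorem relay_exec_cases (S R : ℕ → ℕ → Prop) (st : V → Node P) (v : V) :
    (relay S R).exec G ID B st v = st v ∨
    ∃ u t, G.Adj v u ∧ (st v).tok = none ∧ R (st v).clu (st v).lay ∧ (st u).tok = some t ∧
      S (st u).clu (st u).lay ∧
      (relay S R).exec G ID B st v = { st v with tok := some t.succ } := by
  cases h : recv G ID B (fun u => (relay S R).role (st u)) v with
  | none => left; rw [Instr.exec, h]; rfl
  | some t =>
    right
    obtain ⟨h1, u, hu, h2⟩ := recv_some h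
    rw [relay_role_listen] at h1
    rw [relay_role_send] at h2
    refine ⟨u, t, hu, h1.1, h1.2, h2.1, h2.2, ?_⟩
    rw [Instr.exec, h]
    rfl

theorem relay_grows (S R : ℕ → ℕ → Prop) (st : V → Node P) :
    Grows G st ((relay S R).exec G ID B st) := by
  have key : ∀ v t, (st v).tok = some t → ((relay S R).exec G ID B st v).tok = some t := by
    intro v t ht
    rcases relay_exec_cases G ID B S R st v with h | ⟨u, t', hu, h1, _⟩
    · rw [h, ht]
    · rw [ht] at h1; simp at h1
  refine ⟨?_, ?_, ?_, ?_, key, fun v t' ht => ?_⟩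
  any_goals
    intro v
    rcases relay_exec_cases G ID B S R st v with h | ⟨u, t, hu, h1, h2, h3, h4, h⟩ <;> rw [h]
  rcases relay_exec_cases G ID B S R st v with h | ⟨u, t, hu, h1, h2, h3, h4, h⟩
  · exact .inl (by rw [← h, ht])
  · rw [h] at ht
    exact .inr ⟨u, t, hu, key u t h3, by simpa using ht.symm⟩

/-- The token that arrives may come from any neighbor with label in `S`, not necessarily from `u`;
only its existence is guaranteed. -/
theorem relay_reaches (hID : Function.Injective ID) (hB : ∀ v, ID v < 2 ^ B)
    {S R : ℕ → ℕ → Prop} {st : V → Node P} {v u : V} (hu : G.Adj v u)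
    (hR : R (st v).clu (st v).lay) (hS : S (st u).clu (st u).lay) (ht : (st u).tok ≠ none) :
    ((relay S R).exec G ID B st v).tok ≠ none := by
  obtain ⟨t, ht⟩ := Option.ne_none_iff_exists'.1 ht
  cases hv : (st v).tok with
  | some t' => rw [(relay_grows G ID B S R st).tok v t' hv]; simp
  | none =>
    have h := recv_ne_none (G := G) (act := fun u => (relay S R).role (st u)) hID hB
      (relay_role_listen.2 ⟨hv, hR⟩) hu (relay_role_send.2 ⟨ht, hS⟩)
    obtain ⟨t', ht'⟩ := Option.ne_none_iff_exists'.1 h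
    rw [Instr.exec, ht']
    simp [relay]

theorem exec_grows (l : List (Instr (Node P) (Token P))) (hl : ∀ i ∈ l, ∃ S R, i = relay S R)
    (st : V → Node P) : Grows G st (exec G ID B l st) := by
  induction l generalizing st with
  | nil => exact Grows.refl G st
  | cons i l ih =>
    obtain ⟨S, R, rfl⟩ := hl i (by simp)
    exact (relay_grows G ID B S R st).trans (ih (fun j hj => hl j (by simp [hj])) _)

/-- Tokens passed on within clusters do not leave them. -/
theorem exec_inside (l : List (Instr (Node P) (Token P)))
    (hl : ∀ i ∈ l, ∃ (c : ℕ) (S R : ℕ → Prop),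
      i = relay (fun c' x => c' = c ∧ S x) (fun c' x => c' = c ∧ R x))
    (st : V → Node P) (v : V) (hv : (exec G ID B l st v).tok ≠ none) :
    ∃ w, (st w).clu = (st v).clu ∧ (st w).tok ≠ none := by
  induction l generalizing st with
  | nil => exact ⟨v, rfl, hv⟩
  | cons i l ih =>
    obtain ⟨c, S, R, rfl⟩ := hl i (by simp)
    obtain ⟨w, hw, ht⟩ := ih (fun j hj => hl j (by simp [hj])) _ hv
    have hg := relay_grows G ID B (fun c' x => c' = c ∧ S x) (fun c' x => c' = c ∧ R x) st
    rw [hg.clu, hg.clu] at hw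
    rcases relay_exec_cases G ID B (fun c' x => c' = c ∧ S x) (fun c' x => c' = c ∧ R x) st w with
      h | ⟨u, t, hu, h1, h2, h3, h4, h⟩
    · exact ⟨w, hw, h ▸ ht⟩
    · exact ⟨u, by rw [h4.1, ← hw, h2.1], by simp [h3]⟩

end Relay

/-- All clusters in turn pass on tokens from layer `a` to layer `b`. -/
noncomputable def level (N a b : ℕ) : List (Instr (Node P) (Token P)) :=
  (List.range (N + 1)).map fun c => relay (fun c' x => c' = c ∧ x = a) (fun c' x => c' = c ∧ x = b)

/-- All clusters pass on tokens from layer `n` up to layer `0`. -/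
noncomputable def upSweep (N : ℕ) : ℕ → List (Instr (Node P) (Token P))
  | 0 => []
  | n + 1 => level N (n + 1) n ++ upSweep N n

/-- All clusters pass on tokens from layer `0` down to layer `n`. -/
noncomputable def downSweep (N : ℕ) : ℕ → List (Instr (Node P) (Token P))
  | 0 => []
  | n + 1 => downSweep N n ++ level N n (n + 1)

/-- Every cluster that contains or is adjacent to a device with a token spreads tokens to all its
devices. -/
noncomputable def grow (n N : ℕ) : List (Instr (Node P) (Token P)) :=
  relay (fun _ _ => True) (fun _ _ => True) :: (upSweep N n ++ downSweep N n)

theorem level_inside (N a b : ℕ) : ∀ i ∈ level (P := P) N a b, ∃ (c : ℕ) (S R : ℕ → Prop),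
    i = relay (fun c' x => c' = c ∧ S x) (fun c' x => c' = c ∧ R x) := by
  intro i hi
  obtain ⟨c, _, rfl⟩ := List.mem_map.1 hi
  exact ⟨c, _, _, rfl⟩

theorem upSweep_inside (N n : ℕ) : ∀ i ∈ upSweep (P := P) N n, ∃ (c : ℕ) (S R : ℕ → Prop),
    i = relay (fun c' x => c' = c ∧ S x) (fun c' x => c' = c ∧ R x) := by
  induction n with
  | zero => simp [upSweep]
  | succ n ih =>
    intro i hi
    rcases List.mem_append.1 hi with h | h
    exacts [level_inside N _ _ i h, ih i h]

theorem downSweep_inside (N n : ℕ) : ∀ i ∈ downSweep (P := P) N n, ∃ (c : ℕ) (S R : ℕ → Prop),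
    i = relay (fun c' x => c' = c ∧ S x) (fun c' x => c' = c ∧ R x) := by
  induction n with
  | zero => simp [downSweep]
  | succ n ih =>
    intro i hi
    rcases List.mem_append.1 hi with h | h
    exacts [ih i h, level_inside N _ _ i h]

theorem length_level (N a b : ℕ) : (level (P := P) N a b).length = N + 1 := by
  simp [level]

theorem length_upSweep (N n : ℕ) : (upSweep (P := P) N n).length = n * (N + 1) := by
  induction n with
  | zero => simp [upSweep]
  | succ n ih => rw [upSweep, List.length_append, length_level, ih]; ring

theorem length_downSweep (N n : ℕ) : (downSweep (P := P) N n).length = n * (N + 1) := by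
  induction n with
  | zero => simp [downSweep]
  | succ n ih => rw [downSweep, List.length_append, length_level, ih]; ring

theorem length_grow (n N : ℕ) : (grow (P := P) n N).length = 2 * n * (N + 1) + 1 := by
  rw [grow, List.length_cons, List.length_append, length_upSweep, length_downSweep]; ring

/-! ### Correctness and cost of sweeps -/

section Sweep

variable (G : SimpleGraph V) (ID : V → ℕ) (B : ℕ)

theorem level_grows (N a b : ℕ) (st : V → Node P) : Grows G st (exec G ID B (level N a b) st) :=
  exec_grows G ID B _ (fun i hi => by
    obtain ⟨c, S, R, h⟩ := level_inside N a b i hi; exact ⟨_, _, h⟩) st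

theorem upSweep_grows (N n : ℕ) (st : V → Node P) : Grows G st (exec G ID B (upSweep N n) st) :=
  exec_grows G ID B _ (fun i hi => by
    obtain ⟨c, S, R, h⟩ := upSweep_inside N n i hi; exact ⟨_, _, h⟩) st

theorem downSweep_grows (N n : ℕ) (st : V → Node P) :
    Grows G st (exec G ID B (downSweep N n) st) :=
  exec_grows G ID B _ (fun i hi => by
    obtain ⟨c, S, R, h⟩ := downSweep_inside N n i hi; exact ⟨_, _, h⟩) st

theorem grow_grows (n N : ℕ) (st : V → Node P) : Grows G st (exec G ID B (grow n N) st) := by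
  rw [grow, exec, exec_append]
  exact ((relay_grows G ID B _ _ st).trans (upSweep_grows G ID B N n _)).trans
    (downSweep_grows G ID B N n _)

/-- Only the instruction for the cluster of `v` matters; those before and after it keep tokens in
place. -/
theorem level_reaches (hID : Function.Injective ID) (hB : ∀ v, ID v < 2 ^ B) {N a b : ℕ}
    {st : V → Node P} {v u : V} (hu : G.Adj v u) (hN : (st v).clu ≤ N)
    (huv : (st u).clu = (st v).clu) (ha : (st u).lay = a) (hb : (st v).lay = b)
    (ht : (st u).tok ≠ none) : (exec G ID B (level N a b) st v).tok ≠ none := by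
  obtain ⟨l₁, l₂, hl⟩ := List.append_of_mem (List.mem_range.2 (Nat.lt_succ_of_le hN))
  have hmap : ∀ (l : List ℕ) (st : V → Node P), Grows G st (exec G ID B (l.map fun c =>
      relay (fun c' x => c' = c ∧ x = a) (fun c' x => c' = c ∧ x = b)) st) := fun l st =>
    exec_grows G ID B _ (fun i hi => by
      obtain ⟨c, _, rfl⟩ := List.mem_map.1 hi; exact ⟨_, _, rfl⟩) st
  rw [level, hl, List.map_append, List.map_cons, exec_append, exec]
  refine (hmap l₂ _).tok_ne_none ?_
  have h := hmap l₁ st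
  refine relay_reaches G ID B hID hB hu ?_ ?_ (h.tok_ne_none ht)
  · exact ⟨h.clu v, (h.lay v).trans hb⟩
  · exact ⟨(h.clu u).trans huv, (h.lay u).trans ha⟩

/-- Every cluster is a connected set whose devices are arranged in layers below the device which
gives its ID to the cluster. -/
structure Layered (st : V → Node P) : Prop where
  root : ∀ v, (st v).lay = 0 → (st v).clu = ID v
  parent : ∀ v d, (st v).lay = d + 1 →
    ∃ u, G.Adj v u ∧ (st u).clu = (st v).clu ∧ (st u).lay = d

variable {G ID B}

theorem Layered.of_grows {st st' : V → Node P} (h : Layered G ID st) (hg : Grows G st st') :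
    Layered G ID st' where
  root v hv := by rw [hg.clu]; exact h.root v (by rw [← hg.lay, hv])
  parent v d hv := by
    obtain ⟨u, h1, h2, h3⟩ := h.parent v d (by rw [← hg.lay, hv])
    exact ⟨u, h1, by rw [hg.clu, hg.clu, h2], by rw [hg.lay, h3]⟩

theorem Layered.exists_le {st : V → Node P} (h : Layered G ID st) (v : V) (d : ℕ)
    (hd : d ≤ (st v).lay) : ∃ u, (st u).clu = (st v).clu ∧ (st u).lay = d := by
  obtain ⟨k, hk⟩ := Nat.exists_eq_add_of_le hd
  induction k generalizing v with
  | zero => exact ⟨v, rfl, by omega⟩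
  | succ k ih =>
    obtain ⟨u, _, h2, h3⟩ := h.parent v (d + k) (by omega)
    obtain ⟨w, h4, h5⟩ := ih u (by omega) (by omega)
    exact ⟨w, h4.trans h2, h5⟩

theorem Layered.clu_le {st : V → Node P} (h : Layered G ID st) {N : ℕ} (hN : ∀ v, ID v ≤ N)
    (v : V) : (st v).clu ≤ N := by
  obtain ⟨u, h1, h2⟩ := h.exists_le v 0 (Nat.zero_le _)
  rw [← h1, h.root u h2]
  exact hN u

/-- All layers up to that of `v` are occupied, by distinct devices. Hence sweeps over `n` layers
cover every cluster. -/
theorem Layered.lay_lt [Fintype V] {st : V → Node P} (h : Layered G ID st) (v : V) :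
    (st v).lay < Fintype.card V := by
  classical
  have : Finset.range ((st v).lay + 1) ⊆ Finset.univ.image fun u => (st u).lay := by
    intro d hd
    obtain ⟨u, _, hu⟩ := h.exists_le v d (by simpa [Nat.lt_succ_iff] using hd)
    exact Finset.mem_image.2 ⟨u, Finset.mem_univ u, hu⟩
  have := (Finset.card_le_card this).trans Finset.card_image_le
  simpa using this

/-- A holder in the deepest layer has a parent in its own cluster that obtains a token in the first
level; induction does the rest. -/
theorem upSweep_reaches (hID : Function.Injective ID) (hB : ∀ v, ID v < 2 ^ B) {N : ℕ}
    (hN : ∀ v, ID v ≤ N) (n : ℕ) {st : V → Node P} (h : Layered G ID st) {u : V}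
    (hu : (st u).lay ≤ n) (ht : (st u).tok ≠ none) :
    ∃ r, (st r).clu = (st u).clu ∧ (st r).lay = 0 ∧
      (exec G ID B (upSweep N n) st r).tok ≠ none := by
  induction n generalizing st u with
  | zero => exact ⟨u, rfl, by omega, ht⟩
  | succ n ih =>
    have hg := level_grows G ID B N (n + 1) n st
    have key : ∃ w, (st w).clu = (st u).clu ∧ (st w).lay ≤ n ∧
        (exec G ID B (level N (n + 1) n) st w).tok ≠ none := by
      by_cases hlt : (st u).lay ≤ n
      · exact ⟨u, rfl, hlt, hg.tok_ne_none ht⟩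
      · obtain ⟨w, h1, h2, h3⟩ := h.parent u n (by omega)
        exact ⟨w, h2, h3.le, level_reaches G ID B hID hB h1.symm (h.clu_le hN w) h2.symm
          (by omega) h3 ht⟩
    obtain ⟨w, h1, h2, h3⟩ := key
    obtain ⟨r, h4, h5, h6⟩ := ih (h.of_grows hg) (by rwa [hg.lay]) h3
    rw [hg.clu, hg.clu] at h4
    rw [hg.lay] at h5
    refine ⟨r, h4.trans h1, h5, ?_⟩
    rw [upSweep, exec_append]
    exact h6

/-- Layer `0` of a cluster is a single device, since its ID is the cluster ID; deeper layers are
served by their parents. -/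
theorem downSweep_reaches (hID : Function.Injective ID) (hB : ∀ v, ID v < 2 ^ B) {N : ℕ}
    (hN : ∀ v, ID v ≤ N) (n : ℕ) {st : V → Node P} (h : Layered G ID st) {r v : V}
    (hr : (st r).lay = 0) (ht : (st r).tok ≠ none) (hv : (st v).clu = (st r).clu)
    (hn : (st v).lay ≤ n) : (exec G ID B (downSweep N n) st v).tok ≠ none := by
  induction n generalizing v with
  | zero =>
    have h1 := h.root v (by omega)
    have h2 := h.root r hr
    obtain rfl : v = r := hID (by omega)
    exact ht
  | succ n ih =>
    have hg := downSweep_grows G ID B N n st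
    rw [downSweep, exec_append]
    by_cases hlt : (st v).lay ≤ n
    · exact (level_grows G ID B N n (n + 1) _).tok_ne_none (ih hv hlt)
    · obtain ⟨u, h1, h2, h3⟩ := h.parent v n (by omega)
      refine level_reaches G ID B hID hB h1 ?_ ?_ ?_ ?_ (ih (h2.trans hv) h3.le)
      · rw [hg.clu]; exact h.clu_le hN v
      · rw [hg.clu, hg.clu, h2]
      · rw [hg.lay, h3]
      · rw [hg.lay]; omega

/-- The devices in clusters that meet or are adjacent to `X`. -/
def clusterNbhd (G : SimpleGraph V) (clu : V → ℕ) (X : Set V) : Set V :=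
  {v | ∃ w u, clu w = clu v ∧ u ∈ X ∧ (w = u ∨ G.Adj w u)}

/-- The devices that have a token. -/
def holders (st : V → Node P) : Set V := {v | (st v).tok ≠ none}

/-- Equality is needed: the selection relies on tokens reaching all nearby clusters and also on
their reaching no others. -/
theorem holders_grow [Fintype V] (hID : Function.Injective ID) (hB : ∀ v, ID v < 2 ^ B) {N : ℕ}
    (hN : ∀ v, ID v ≤ N) {st : V → Node P} (h : Layered G ID st) :
    holders (exec G ID B (grow (Fintype.card V) N) st) =
      clusterNbhd G (fun v => (st v).clu) (holders st) := by
  have hg := relay_grows G ID B (fun _ _ => True) (fun _ _ => True) st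
  ext v
  constructor
  · intro hv
    -- The sweeps do not cross cluster borders, so some `w` in the cluster of `v` held a token right
    -- after the initial relay.
    obtain ⟨w, h1, h2⟩ := exec_inside G ID B _ (fun i hi => (List.mem_append.1 hi).elim
      (upSweep_inside N _ i) (downSweep_inside N _ i)) _ v hv
    rw [hg.clu, hg.clu] at h1
    obtain ⟨t, ht⟩ := Option.ne_none_iff_exists'.1 h2
    rcases hg.new w t ht with h3 | ⟨u, t', hu, h3, h4⟩
    · exact ⟨w, w, h1, by simp [holders, h3], .inl rfl⟩
    · rcases relay_exec_cases G ID B (fun _ _ => True) (fun _ _ => True) st w with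
        h5 | ⟨u, t, hu, _, _, h6, _⟩
      · exact ⟨w, w, h1, by simp [holders, ← h5, ht], .inl rfl⟩
      · exact ⟨w, u, h1, by simp [holders, h6], .inr hu⟩
  · rintro ⟨w, u, h1, h2, h3⟩
    have hw : ((relay (fun _ _ => True) (fun _ _ => True)).exec G ID B st w).tok ≠ none := by
      rcases h3 with rfl | h3
      · exact hg.tok_ne_none h2
      · exact relay_reaches G ID B hID hB h3 trivial trivial h2
    have hL := h.of_grows hg
    obtain ⟨r, h4, h5, h6⟩ := upSweep_reaches hID hB hN (Fintype.card V) hL (hL.lay_lt w).le hw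
    have hg' := upSweep_grows G ID B N (Fintype.card V)
      ((relay (fun _ _ => True) (fun _ _ => True)).exec G ID B st)
    have hL' := hL.of_grows hg'
    change (exec G ID B (grow (Fintype.card V) N) st v).tok ≠ none
    rw [grow, exec, exec_append]
    refine downSweep_reaches hID hB hN _ hL' (by rwa [hg'.lay]) h6 ?_ (hL'.lay_lt v).le
    rw [hg'.clu, hg'.clu, h4, hg.clu, hg.clu]
    exact h1.symm

variable (G ID B)

/-- A device is active only in the instruction of its own cluster, which occurs once. -/
theorem rounds_level (N a b : ℕ) (st : V → Node P) (v : V) :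
    rounds G ID B v (level N a b) st ≤
      (if (st v).lay = a then 1 else 0) + if (st v).lay = b then 1 else 0 := by
  have key : ∀ (l : List ℕ) (st : V → Node P), l.Nodup →
      rounds G ID B v (l.map fun c => relay (fun c' x => c' = c ∧ x = a)
        (fun c' x => c' = c ∧ x = b)) st ≤
      if (st v).clu ∈ l ∧ ((st v).lay = a ∨ (st v).lay = b) then 1 else 0 := by
    intro l
    induction l with
    | nil => intro st _; simp [rounds]
    | cons c l ih =>
      intro st hl
      have hg := relay_grows G ID B (fun c' x => c' = c ∧ x = a) (fun c' x => c' = c ∧ x = b) st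
      have h1 := ih ((relay (fun c' x => c' = c ∧ x = a)
        (fun c' x => c' = c ∧ x = b)).exec G ID B st) (List.nodup_cons.1 hl).2
      rw [hg.clu, hg.lay] at h1
      rw [List.map_cons, rounds]
      have hc := (List.nodup_cons.1 hl).1
      have h2 := relay_cost (S := fun c' x => c' = c ∧ x = a) (R := fun c' x => c' = c ∧ x = b)
        (q := st v)
      by_cases h3 : (st v).clu = c ∧ ((st v).lay = a ∨ (st v).lay = b)
      · rw [if_neg (fun h => hc (h3.1 ▸ h.1))] at h1
        rw [if_pos ⟨by simp [h3.1], h3.2⟩]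
        omega
      · rw [relay_cost_eq_zero (fun h => h3 ⟨h.1, .inl h.2⟩) (fun h => h3 ⟨h.1, .inr h.2⟩),
          zero_add]
        refine h1.trans ?_
        split_ifs with h4 h5 h5
        · exact le_rfl
        · exact absurd ⟨List.mem_cons_of_mem _ h4.1, h4.2⟩ h5
        · simp
        · exact le_rfl
  refine (key _ st List.nodup_range).trans ?_
  split_ifs <;> omega

/-- A device takes part in at most two levels: receiving into its layer and sending out of it. -/
theorem rounds_upSweep (N n : ℕ) (st : V → Node P) (v : V) :
    rounds G ID B v (upSweep N n) st ≤
      (if (st v).lay < n then 1 else 0) + if (st v).lay ≤ n then 1 else 0 := by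
  induction n generalizing st with
  | zero => simp [upSweep, rounds]
  | succ n ih =>
    rw [upSweep, rounds_append]
    have h1 := rounds_level G ID B N (n + 1) n st v
    have h2 := ih (exec G ID B (level N (n + 1) n) st)
    rw [(level_grows G ID B N (n + 1) n st).lay] at h2
    split_ifs at h1 h2 ⊢ <;> omega

theorem rounds_downSweep (N n : ℕ) (st : V → Node P) (v : V) :
    rounds G ID B v (downSweep N n) st ≤
      (if (st v).lay < n then 1 else 0) + if (st v).lay ≤ n then 1 else 0 := by
  induction n generalizing st with
  | zero => simp [downSweep, rounds]
  | succ n ih =>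
    rw [downSweep, rounds_append]
    have h1 := rounds_level G ID B N n (n + 1) (exec G ID B (downSweep N n) st) v
    have h2 := ih st
    rw [(downSweep_grows G ID B N n st).lay] at h1
    split_ifs at h1 h2 ⊢ <;> omega

/-- One relay and two rounds per sweep, independently of `n` and `N`. -/
theorem rounds_grow (n N : ℕ) (st : V → Node P) (v : V) :
    rounds G ID B v (grow n N) st ≤ 5 := by
  rw [grow, rounds, rounds_append]
  have h1 := relay_cost (S := fun _ _ => True) (R := fun _ _ => True) (q := st v)
  have h2 := rounds_upSweep G ID B N n
    ((relay (fun _ _ => True) (fun _ _ => True)).exec G ID B st) v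
  have h3 := rounds_downSweep G ID B N n (exec G ID B (upSweep N n)
    ((relay (fun _ _ => True) (fun _ _ => True)).exec G ID B st)) v
  split_ifs at h2 h3 <;> omega

end Sweep

end Radio

/-! ### Selection of well-separated clusters by the bits of their IDs -/

namespace Radio

variable {V P : Type}

section Selection

variable (G : SimpleGraph V) (clu : V → ℕ)

theorem subset_clusterNbhd (X : Set V) : X ⊆ clusterNbhd G clu X :=
  fun v hv => ⟨v, v, rfl, hv, .inl rfl⟩

theorem clusterNbhd_mono : Monotone (clusterNbhd G clu) := by
  rintro X Y h v ⟨w, u, h1, h2, h3⟩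
  exact ⟨w, u, h1, h h2, h3⟩

theorem mem_clusterNbhd_congr {X : Set V} {u v : V} (h : clu u = clu v) :
    u ∈ clusterNbhd G clu X ↔ v ∈ clusterNbhd G clu X := by
  simp only [clusterNbhd, Set.mem_ofPred_eq, h]

/-- The devices of the clusters that are still selected after `j` bits of the cluster IDs have been
considered. A cluster is dropped in stage `j` if it has bit `j` and is within distance two of a
selected cluster that does not have bit `j`. -/
def selected : ℕ → Set V
  | 0 => Set.univ
  | j + 1 => {v | v ∈ selected j ∧ ¬ ((clu v).testBit j = true ∧ v ∈ clusterNbhd G clu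
      (clusterNbhd G clu {u | u ∈ selected j ∧ (clu u).testBit j = false}))}

theorem mem_selected_congr (j : ℕ) {u v : V} (h : clu u = clu v) :
    u ∈ selected G clu j ↔ v ∈ selected G clu j := by
  induction j with
  | zero => simp [selected]
  | succ j ih =>
    simp only [selected, Set.mem_ofPred_eq]
    rw [ih, h, mem_clusterNbhd_congr G clu h]

theorem selected_anti : Antitone (selected G clu) :=
  antitone_nat_of_succ_le fun _ _ hv => hv.1

/-- Every cluster is close to a selected cluster. -/
theorem selected_covers (j : ℕ) :
    (clusterNbhd G clu)^[2 * j] (selected G clu j) = Set.univ := by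
  induction j with
  | zero => rfl
  | succ j ih =>
    rw [Set.eq_univ_iff_forall] at ih ⊢
    intro v
    rw [show 2 * (j + 1) = 2 * j + 2 by ring, Function.iterate_add_apply]
    refine (clusterNbhd_mono G clu).iterate (2 * j) ?_ (ih v)
    intro u hu
    change u ∈ clusterNbhd G clu (clusterNbhd G clu (selected G clu (j + 1)))
    by_cases h : u ∈ selected G clu (j + 1)
    · exact subset_clusterNbhd G clu _ (subset_clusterNbhd G clu _ h)
    · have h' : (clu u).testBit j = true ∧ u ∈ clusterNbhd G clu
          (clusterNbhd G clu {u | u ∈ selected G clu j ∧ (clu u).testBit j = false}) := by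
        by_contra hc
        exact h ⟨hu, hc⟩
      -- The clusters that cause a drop lack bit `j`, so they survive the stage themselves.
      refine clusterNbhd_mono G clu (clusterNbhd_mono G clu ?_) h'.2
      rintro w ⟨hw, hb⟩
      exact ⟨hw, fun hc => by simp [hb] at hc⟩

/-- Selected clusters are at distance at least three from each other. -/
theorem selected_separated {B : ℕ} (hB : ∀ v, clu v < 2 ^ B) {u v : V}
    (hu : u ∈ selected G clu B) (hv : v ∈ selected G clu B)
    (h1 : v ∈ clusterNbhd G clu (clusterNbhd G clu {w | clu w = clu u}))
    (h2 : u ∈ clusterNbhd G clu (clusterNbhd G clu {w | clu w = clu v})) : clu u = clu v := by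
  have key : ∀ u v j, u ∈ selected G clu B → v ∈ selected G clu B → j < B →
      (clu u).testBit j = false → (clu v).testBit j = true →
      v ∉ clusterNbhd G clu (clusterNbhd G clu {w | clu w = clu u}) := by
    intro u v j hu hv hj hbu hbv h
    have hv' : v ∈ selected G clu (j + 1) := selected_anti G clu hj hv
    have hu' : u ∈ selected G clu j := selected_anti G clu hj.le hu
    -- The cluster of `u` is still selected at stage `j` and lacks bit `j`, so it would have dropped
    -- that of `v`.
    refine hv'.2 ⟨hbv, clusterNbhd_mono G clu (clusterNbhd_mono G clu ?_) h⟩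
    intro w hw
    exact ⟨(mem_selected_congr G clu j hw).2 hu', by rw [show clu w = clu u from hw, hbu]⟩
  refine Nat.eq_of_testBit_eq fun j => ?_
  by_cases hj : j < B
  · cases hbu : (clu u).testBit j <;> cases hbv : (clu v).testBit j
    · rfl
    · exact absurd h1 (key u v j hu hv hj hbu hbv)
    · exact absurd h2 (key v u j hv hu hj hbv hbu)
    · rfl
  · have hlt : ∀ w, clu w < 2 ^ j := fun w =>
      (hB w).trans_le (Nat.pow_le_pow_right two_pos (not_lt.1 hj))
    rw [Nat.testBit_lt_two_pow (hlt u), Nat.testBit_lt_two_pow (hlt v)]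

end Selection

/-! ### Halving the number of clusters -/

section Count

variable [Fintype V] {G : SimpleGraph V} {ID : V → ℕ}

open Classical in
/-- The devices that give their IDs to the clusters. -/
noncomputable def roots (st : V → Node P) : Finset V := {v | (st v).lay = 0}

theorem mem_roots {st : V → Node P} {v : V} : v ∈ roots st ↔ (st v).lay = 0 := by
  simp [roots]

theorem Layered.clu_injOn_roots {st : V → Node P} (h : Layered G ID st)
    (hID : Function.Injective ID) {r r' : V} (hr : r ∈ roots st) (hr' : r' ∈ roots st)
    (hc : (st r).clu = (st r').clu) : r = r' := by
  rw [mem_roots] at hr hr'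
  exact hID (by rw [← h.root r hr, ← h.root r' hr', hc])

/-- If there are at least two clusters, then every cluster has an adjacent one. -/
theorem Layered.exists_adj {st : V → Node P} (h : Layered G ID st)
    (hID : Function.Injective ID) (hG : G.Connected) (hR : 1 < (roots st).card) {r : V}
    (hr : r ∈ roots st) : ∃ q ∈ roots st, (st q).clu ≠ (st r).clu ∧
      ∃ a b, G.Adj a b ∧ (st a).clu = (st r).clu ∧ (st b).clu = (st q).clu := by
  obtain ⟨r', hr', hne⟩ := Finset.exists_mem_ne hR r
  obtain ⟨p⟩ := hG.preconnected r r'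
  obtain ⟨d, _, h1, h2⟩ := p.exists_boundary_dart {w | (st w).clu = (st r).clu} rfl
    (fun hc => hne (h.clu_injOn_roots hID hr' hr hc))
  obtain ⟨q, h3, h4⟩ := h.exists_le d.snd 0 (Nat.zero_le _)
  exact ⟨q, mem_roots.2 h4, fun hc => h2 (h3.symm.trans hc), d.fst, d.snd, d.adj, h1, h3.symm⟩

/-- At most half of the clusters are selected. -/
theorem Layered.two_mul_card_le {st : V → Node P} (h : Layered G ID st)
    (hID : Function.Injective ID) (hG : G.Connected) {B : ℕ} (hB : ∀ v, (st v).clu < 2 ^ B)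
    (hR : 1 < (roots st).card) (S : Finset V) (hS : ∀ r ∈ S, r ∈ roots st ∧
      r ∈ selected G (fun v => (st v).clu) B) : 2 * S.card ≤ (roots st).card := by
  classical
  have h0 : ∀ r : V, ∃ q : V, r ∈ S → q ∈ roots st ∧ (st q).clu ≠ (st r).clu ∧
      ∃ a b, G.Adj a b ∧ (st a).clu = (st r).clu ∧ (st b).clu = (st q).clu := by
    intro r
    by_cases hr : r ∈ S
    · obtain ⟨q, h1, h2⟩ := h.exists_adj hID hG hR (hS r hr).1
      exact ⟨q, fun _ => ⟨h1, h2⟩⟩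
    · exact ⟨r, fun hc => absurd hc hr⟩
  choose f hf using h0
  -- Selected clusters with a common neighboring cluster are at distance at most two, hence equal.
  have hinj : Set.InjOn f S := by
    have near : ∀ r ∈ S, ∀ r' ∈ S, f r = f r' → r' ∈ clusterNbhd G (fun v => (st v).clu)
        (clusterNbhd G (fun v => (st v).clu) {w | (st w).clu = (st r).clu}) := by
      intro r hr r' hr' he
      obtain ⟨_, _, a, b, hab, ha, hb⟩ := hf r hr
      obtain ⟨_, _, a', b', hab', ha', hb'⟩ := hf r' hr'
      exact ⟨a', b', ha', ⟨b, a, hb.trans (he ▸ hb'.symm), ha, .inr hab.symm⟩, .inr hab'⟩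
    intro r hr r' hr' he
    exact h.clu_injOn_roots hID (hS r hr).1 (hS r' hr').1
      (selected_separated G (fun v => (st v).clu) hB (hS r hr).2 (hS r' hr').2
        (near r hr r' hr' he) (near r' hr' r hr he.symm))
  -- A cluster adjacent to a selected one is too close to be selected.
  have hdisj : Disjoint S (S.image f) := by
    rw [Finset.disjoint_left]
    intro q hq hq'
    obtain ⟨r, hr, rfl⟩ := Finset.mem_image.1 hq'
    obtain ⟨_, hne, a, b, hab, ha, hb⟩ := hf r hr
    refine hne (selected_separated G (fun v => (st v).clu) hB (hS _ hq).2 (hS r hr).2 ?_ ?_)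
    · exact subset_clusterNbhd _ _ _ ⟨a, b, ha, hb, .inr hab⟩
    · exact subset_clusterNbhd _ _ _ ⟨b, a, hb, ha, .inr hab.symm⟩
  have hsub : S ∪ S.image f ⊆ roots st := by
    intro q hq
    rcases Finset.mem_union.1 hq with hq | hq
    · exact (hS q hq).1
    · obtain ⟨r, hr, rfl⟩ := Finset.mem_image.1 hq
      exact (hf r hr).1
  have := Finset.card_le_card hsub
  rw [Finset.card_union_of_disjoint hdisj, Finset.card_image_of_injOn hinj] at this
  omega

end Count

/-- A local computation. -/
def localStep (g : Node P → Node P) : Instr (Node P) (Token P) := ⟨fun _ => .idle, fun q _ => g q⟩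

/-- Devices with `b` take their own label as token, all others discard their tokens. -/
def Node.seed (b : Node P → Bool) (q : Node P) : Node P :=
  { q with tok := if b q then some ⟨none, q.clu, q.lay⟩ else none }

/-- The devices of all clusters get selected. -/
def Node.select (q : Node P) : Node P := { q with mem := true }

/-- Clusters with bit `j` that have received tokens are not selected any more. -/
def Node.drop (j : ℕ) (q : Node P) : Node P :=
  { q with mem := q.mem && !(q.clu.testBit j && q.tok.isSome) }

/-- The token becomes the new label. -/
def Node.adopt (q : Node P) : Node P :=
  match q.tok with
  | some t => { q with clu := t.clu, lay := t.lay }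
  | none => q

/-- The selection of clusters, based on the first `j` bits of the cluster IDs. -/
noncomputable def selection (n N : ℕ) : ℕ → List (Instr (Node P) (Token P))
  | 0 => [localStep Node.select]
  | j + 1 => selection n N j ++
      (localStep (Node.seed fun q => q.mem && !q.clu.testBit j) ::
        (grow n N ++ (grow n N ++ [localStep (Node.drop j)])))

/-- Tokens spread from clusters to adjacent clusters `k` times. -/
noncomputable def spread (n N : ℕ) : ℕ → List (Instr (Node P) (Token P))
  | 0 => []
  | k + 1 => spread n N k ++ grow n N

/-- The selected clusters absorb all other clusters. -/
noncomputable def merge (n N : ℕ) : List (Instr (Node P) (Token P)) :=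
  selection n N (Nat.size N) ++ (localStep (Node.seed Node.mem) ::
    (spread n N (2 * Nat.size N) ++ [localStep Node.adopt]))

/-! ### Correctness of a merge -/

section Merge

variable {G : SimpleGraph V} {ID : V → ℕ} {B : ℕ}

theorem exec_localStep (g : Node P → Node P) (l : List (Instr (Node P) (Token P)))
    (st : V → Node P) :
    exec G ID B (localStep g :: l) st = exec G ID B l fun v => g (st v) := rfl

theorem rounds_localStep (g : Node P → Node P) (l : List (Instr (Node P) (Token P)))
    (st : V → Node P) (v : V) : rounds G ID B v (localStep g :: l) st =
      rounds G ID B v l fun v => g (st v) :=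
  Nat.zero_add _

theorem Layered.congr {st st' : V → Node P} (h : Layered G ID st)
    (hc : ∀ v, (st' v).clu = (st v).clu) (hl : ∀ v, (st' v).lay = (st v).lay) :
    Layered G ID st' where
  root v hv := by rw [hc]; exact h.root v (by rw [← hl, hv])
  parent v d hv := by
    obtain ⟨u, h1, h2, h3⟩ := h.parent v d (by rw [← hl, hv])
    exact ⟨u, h1, by rw [hc, hc, h2], by rw [hl, h3]⟩

theorem spread_grows (n N k : ℕ) (st : V → Node P) :
    Grows G st (exec G ID B (spread n N k) st) := by
  induction k with
  | zero => exact Grows.refl G st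
  | succ k ih =>
    rw [spread, exec_append]
    exact ih.trans (grow_grows G ID B n N _)

variable [Fintype V]

/-- Two growth steps from the selected clusters without bit `j` mark exactly the clusters within
distance two of them, so the flag `mem` computes `selected`. -/
theorem exec_selection (hID : Function.Injective ID) (hB : ∀ v, ID v < 2 ^ B) {N : ℕ}
    (hN : ∀ v, ID v ≤ N) {st : V → Node P} (h : Layered G ID st) (j : ℕ) (v : V) :
    (exec G ID B (selection (Fintype.card V) N j) st v).clu = (st v).clu ∧
    (exec G ID B (selection (Fintype.card V) N j) st v).lay = (st v).lay ∧
    (exec G ID B (selection (Fintype.card V) N j) st v).pay = (st v).pay ∧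
    ((exec G ID B (selection (Fintype.card V) N j) st v).mem = true ↔
      v ∈ selected G (fun v => (st v).clu) j) := by
  induction j generalizing v with
  | zero => exact ⟨rfl, rfl, rfl, by simp [selected, selection, exec, Instr.exec, localStep,
      Node.select]⟩
  | succ j ih =>
    rw [selection, exec_append, exec_localStep, exec_append, exec_append, exec_localStep]
    set a := exec G ID B (selection (Fintype.card V) N j) st
    set b : V → Node P := fun v => (a v).seed fun q => q.mem && !q.clu.testBit j with hb
    have hLb : Layered G ID b := h.congr (fun v => (ih v).1) (fun v => (ih v).2.1)
    have hg := grow_grows G ID B (Fintype.card V) N b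
    have hg' := grow_grows G ID B (Fintype.card V) N (exec G ID B (grow (Fintype.card V) N) b)
    have hh := holders_grow hID hB hN (hLb.of_grows hg)
    rw [holders_grow hID hB hN hLb] at hh
    have hg2 := hg.trans hg'
    set c := exec G ID B (grow (Fintype.card V) N) (exec G ID B (grow (Fintype.card V) N) b)
    have hclu : ∀ v, (b v).clu = (st v).clu := fun v => (ih v).1
    have hhb : holders b = {u | u ∈ selected G (fun v => (st v).clu) j ∧
        (st u).clu.testBit j = false} := by
      ext u
      have h1 := (ih u).1
      have h2 := (ih u).2.2.2
      simp only [holders, hb, Node.seed, Set.mem_ofPred_eq, h1, ← h2]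
      simp
    rw [hhb] at hh
    simp only [hg.clu, hclu] at hh
    refine ⟨(hg2.clu v).trans (ih v).1, (hg2.lay v).trans (ih v).2.1,
      (hg2.pay v).trans (ih v).2.2.1, ?_⟩
    change ((c v).drop j).mem = true ↔ _
    have h1 : (c v).mem = true ↔ v ∈ selected G (fun v => (st v).clu) j := by
      rw [hg2.mem]; exact (ih v).2.2.2
    have h2 : (c v).tok.isSome = true ↔ v ∈ holders c := by
      simp [holders, Option.isSome_iff_ne_none]
    rw [hh] at h2
    simp only [Node.drop, selected, Set.mem_ofPred_eq, ← h1, ← h2, hg2.clu v, hclu v]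
    cases (st v).clu.testBit j <;> simp

theorem holders_spread (hID : Function.Injective ID) (hB : ∀ v, ID v < 2 ^ B) {N : ℕ}
    (hN : ∀ v, ID v ≤ N) {st : V → Node P} (h : Layered G ID st) (k : ℕ) :
    holders (exec G ID B (spread (Fintype.card V) N k) st) =
      (clusterNbhd G (fun v => (st v).clu))^[k] (holders st) := by
  induction k with
  | zero => rfl
  | succ k ih =>
    have hg := spread_grows (G := G) (ID := ID) (B := B) (Fintype.card V) N k st
    rw [spread, exec_append, holders_grow hID hB hN (h.of_grows hg), ih,
      Function.iterate_succ_apply']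
    simp only [hg.clu]

/-- Every token is either a seed, that is, the old label of a device in a selected cluster, or the
successor of a neighbor's token. Used as labels, the tokens therefore form layered clusters again,
however they travelled. -/
theorem exec_merge (hID : Function.Injective ID) (hB : ∀ v, ID v < 2 ^ B) {N : ℕ}
    (hN : ∀ v, ID v ≤ N) (hG : G.Connected) {st : V → Node P} (h : Layered G ID st) :
    (∀ v, (exec G ID B (merge (Fintype.card V) N) st v).pay = (st v).pay) ∧
    Layered G ID (exec G ID B (merge (Fintype.card V) N) st) ∧
    (roots (exec G ID B (merge (Fintype.card V) N) st)).card ≤ (roots st).card ∧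
    (1 < (roots st).card →
      2 * (roots (exec G ID B (merge (Fintype.card V) N) st)).card ≤ (roots st).card) := by
  rw [merge, exec_append, exec_localStep, exec_append, exec_localStep]
  have hsel := exec_selection hID hB hN h (Nat.size N)
  set a := exec G ID B (selection (Fintype.card V) N (Nat.size N)) st
  set b : V → Node P := fun v => (a v).seed Node.mem with hb
  have hLb : Layered G ID b := h.congr (fun v => (hsel v).1) (fun v => (hsel v).2.1)
  have hg := spread_grows (G := G) (ID := ID) (B := B) (Fintype.card V) N (2 * Nat.size N) b
  have hh := holders_spread hID hB hN hLb (2 * Nat.size N)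
  set c := exec G ID B (spread (Fintype.card V) N (2 * Nat.size N)) b
  have hbtok : ∀ v t, (b v).tok = some t ↔ v ∈ selected G (fun v => (st v).clu) (Nat.size N) ∧
      t = ⟨none, (st v).clu, (st v).lay⟩ := by
    intro v t
    simp only [hb, Node.seed, ← (hsel v).2.2.2, (hsel v).1, (hsel v).2.1]
    by_cases hm : (a v).mem = true <;> simp [hm, eq_comm]
  have hhb : holders b = selected G (fun v => (st v).clu) (Nat.size N) := by
    ext v
    simp only [holders, Set.mem_ofPred_eq, Option.ne_none_iff_exists', hbtok]
    simp
  have hclu : ∀ v, (b v).clu = (st v).clu := fun v => (hsel v).1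
  simp only [hhb, hclu, selected_covers] at hh
  have hall : ∀ v, ∃ t, (c v).tok = some t := fun v =>
    Option.ne_none_iff_exists'.1 (hh ▸ Set.mem_univ v : v ∈ holders c)
  have hcases : ∀ v, ∃ t, (c v).tok = some t ∧ (c v).adopt.clu = t.clu ∧
      (c v).adopt.lay = t.lay ∧ ((v ∈ selected G (fun v => (st v).clu) (Nat.size N) ∧
        t = ⟨none, (st v).clu, (st v).lay⟩) ∨
      ∃ u, G.Adj v u ∧ (c u).adopt.clu = t.clu ∧ t.lay = (c u).adopt.lay + 1) := by
    intro v
    obtain ⟨t, ht⟩ := hall v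
    refine ⟨t, ht, by simp [Node.adopt, ht], by simp [Node.adopt, ht], ?_⟩
    rcases hg.new v t ht with h1 | ⟨u, t', hu, h1, h2⟩
    · exact .inl ((hbtok v t).1 h1)
    · exact .inr ⟨u, hu, by simp [Node.adopt, h1, h2, Token.succ],
        by simp [Node.adopt, h1, h2, Token.succ]⟩
  -- Successor tokens have positive layer, so the new roots are old roots of selected clusters.
  have hroot : ∀ v, (c v).adopt.lay = 0 → (st v).lay = 0 ∧
      (c v).adopt.clu = (st v).clu ∧ v ∈ selected G (fun v => (st v).clu) (Nat.size N) := by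
    intro v hv
    obtain ⟨t, _, h2, h3, ⟨h4, rfl⟩ | ⟨u, _, _, h6⟩⟩ := hcases v
    · exact ⟨h3.symm.trans hv, h2, h4⟩
    · omega
  have hsub : roots (fun v => (c v).adopt) ⊆ roots st := fun v hv =>
    mem_roots.2 (hroot v ((mem_roots (st := fun v => (c v).adopt)).1 hv)).1
  refine ⟨fun v => ?_, ⟨fun v hv => ?_, fun v d hv => ?_⟩, Finset.card_le_card hsub,
    fun hR => ?_⟩
  · change (c v).adopt.pay = _
    obtain ⟨t, ht⟩ := hall v
    rw [show (c v).adopt.pay = (c v).pay by simp [Node.adopt, ht], hg.pay]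
    exact (hsel v).2.2.1
  · obtain ⟨h1, h2, _⟩ := hroot v hv
    exact h2.trans (h.root v h1)
  · obtain ⟨t, _, h2, h3, ⟨h4, rfl⟩ | ⟨u, hu, h5, h6⟩⟩ := hcases v
    -- A seeded device keeps its old parent, which lies in the same selected cluster and so was
    -- seeded too.
    · obtain ⟨u, h5, h6, h7⟩ := h.parent v d (h3.symm.trans hv)
      have h8 := hg.tok u _ ((hbtok u _).2
        ⟨(mem_selected_congr G (fun v => (st v).clu) _ h6).2 h4, rfl⟩)
      refine ⟨u, h5, ?_, ?_⟩
      · exact (show (c u).adopt.clu = (st u).clu by simp [Node.adopt, h8]).trans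
          (h6.trans h2.symm)
      · exact (show (c u).adopt.lay = (st u).lay by simp [Node.adopt, h8]).trans h7
    · refine ⟨u, hu, h5.trans h2.symm, ?_⟩
      have : (c v).adopt.lay = d + 1 := hv
      change (c u).adopt.lay = d
      omega
  · refine h.two_mul_card_le hID hG (B := Nat.size N)
      (fun v => (h.clu_le hN v).trans_lt (Nat.lt_size_self N)) hR _ fun r hr => ?_
    obtain ⟨h1, _, h2⟩ := hroot r ((mem_roots (st := fun v => (c v).adopt)).1 hr)
    exact ⟨mem_roots.2 h1, h2⟩

end Merge

end Radio

/-! ### The broadcast program -/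

namespace Radio

variable {V P : Type}

/-- Repeated merging of clusters. -/
noncomputable def mergeMany (n N : ℕ) : ℕ → List (Instr (Node P) (Token P))
  | 0 => []
  | k + 1 => mergeMany n N k ++ merge n N

/-- A device that knows the payload takes it as token. -/
def Node.load (q : Node P) : Node P := { q with tok := q.pay.map fun p => ⟨some p, 0, 0⟩ }

/-- The payload of the token becomes known. -/
def Node.unload (q : Node P) : Node P := { q with pay := q.tok.bind Token.pay }

/-- The broadcast program: clusters are merged until there is only one left, in which the payload
is then spread. -/
noncomputable def broadcast (n N : ℕ) : List (Instr (Node P) (Token P)) :=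
  if n ≤ 1 then [] else
    mergeMany n N (Nat.size n) ++ (localStep Node.load :: (grow n N ++ [localStep Node.unload]))

/-- Initially every device forms a cluster of its own. -/
def Node.init (id : ℕ) (input : Option P) : Node P := ⟨id, 0, true, none, input⟩

/-- A token is traced back to an initial one; each step back lowers the layer by one and keeps the
payload. -/
theorem Grows.tok_pay {G : SimpleGraph V} {st st' : V → Node P} (h : Grows G st st') {p : Option P}
    (hp : ∀ v t, (st v).tok = some t → t.pay = p) (v : V) (t : Token P)
    (ht : (st' v).tok = some t) : t.pay = p := by
  obtain ⟨d, hd⟩ : ∃ d, t.lay = d := ⟨_, rfl⟩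
  induction d generalizing v t with
  | zero =>
    rcases h.new v t ht with h1 | ⟨u, t', _, _, rfl⟩
    · exact hp v t h1
    · simp [Token.succ] at hd
  | succ d ih =>
    rcases h.new v t ht with h1 | ⟨u, t', _, h2, rfl⟩
    · exact hp v t h1
    · exact ih u t' h2 (by simpa [Token.succ] using hd)

section Correctness

variable [Fintype V] {G : SimpleGraph V} {ID : V → ℕ} {B : ℕ}

/-- The alternative is needed because halving requires at least two clusters; a single one just
persists. -/
theorem exec_mergeMany (hID : Function.Injective ID) (hB : ∀ v, ID v < 2 ^ B) {N : ℕ}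
    (hN : ∀ v, ID v ≤ N) (hG : G.Connected) {st : V → Node P} (h : Layered G ID st) (k : ℕ) :
    (∀ v, (exec G ID B (mergeMany (Fintype.card V) N k) st v).pay = (st v).pay) ∧
    Layered G ID (exec G ID B (mergeMany (Fintype.card V) N k) st) ∧
    ((roots (exec G ID B (mergeMany (Fintype.card V) N k) st)).card ≤ 1 ∨
      2 ^ k * (roots (exec G ID B (mergeMany (Fintype.card V) N k) st)).card ≤
        Fintype.card V) := by
  induction k with
  | zero =>
    refine ⟨fun _ => rfl, h, .inr ?_⟩
    rw [pow_zero, one_mul]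
    exact Finset.card_le_univ _
  | succ k ih =>
    rw [mergeMany, exec_append]
    obtain ⟨h1, h2, h3⟩ := ih
    obtain ⟨h4, h5, h6, h7⟩ := exec_merge hID hB hN hG h2
    refine ⟨fun v => (h4 v).trans (h1 v), h5, ?_⟩
    by_cases hR : (roots (exec G ID B (mergeMany (Fintype.card V) N k) st)).card ≤ 1
    · exact .inl (h6.trans hR)
    · right
      refine le_trans ?_ (h3.resolve_left hR)
      rw [pow_succ, mul_assoc]
      exact Nat.mul_le_mul_left _ (h7 (not_le.1 hR))

theorem exec_broadcast (hID : Function.Injective ID) (hB : ∀ v, ID v < 2 ^ B) {N : ℕ}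
    (hN : ∀ v, ID v ≤ N) (hG : G.Connected) (s : V) (m : P) (v : V) :
    (exec G ID B (broadcast (Fintype.card V) N)
      (fun v => open Classical in Node.init (ID v) (if v = s then some m else none)) v).pay =
      some m := by
  classical
  rw [broadcast]
  split_ifs with hn
  · have : v = s := Fintype.card_le_one_iff.1 hn v s
    simp [exec, Node.init, this]
  rw [exec_append, exec_localStep, exec_append]
  have hL : Layered G ID (fun v => Node.init (ID v) (if v = s then some m else none)) :=
    ⟨fun v _ => rfl, fun v d hd => by simp [Node.init] at hd⟩
  obtain ⟨h1, h2, h3⟩ := exec_mergeMany hID hB hN hG hL (Nat.size (Fintype.card V))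
  have h1 : ∀ v, (exec G ID B (mergeMany (Fintype.card V) N (Nat.size (Fintype.card V)))
    (fun v => Node.init (ID v) (if v = s then some m else none)) v).pay =
      if v = s then some m else none := h1
  set a := exec G ID B (mergeMany (Fintype.card V) N (Nat.size (Fintype.card V)))
    (fun v => Node.init (ID v) (if v = s then some m else none))
  have hR : (roots a).card ≤ 1 := by
    rcases h3 with h3 | h3
    · exact h3
    -- `2 ^ Nat.size n` exceeds `n`, so not even one root would fit the bound.
    · by_contra hc
      have h4 := Nat.lt_size_self (Fintype.card V)
      have h5 := Nat.le_mul_of_pos_right (2 ^ Nat.size (Fintype.card V))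
        (show 0 < (roots a).card by omega)
      omega
  have hclu : ∀ u w, (a u).clu = (a w).clu := by
    intro u w
    obtain ⟨r, h4, h5⟩ := h2.exists_le u 0 (Nat.zero_le _)
    obtain ⟨r', h6, h7⟩ := h2.exists_le w 0 (Nat.zero_le _)
    rw [← h4, ← h6, Finset.card_le_one.1 hR r (mem_roots.2 h5) r' (mem_roots.2 h7)]
  set b : V → Node P := fun v => (a v).load with hb
  have hLb : Layered G ID b := h2.congr (fun _ => rfl) (fun _ => rfl)
  have hbtok : ∀ u, (b u).tok = if u = s then some ⟨some m, 0, 0⟩ else none := by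
    intro u
    simp only [hb, Node.load, h1]
    split_ifs <;> rfl
  have hg := grow_grows G ID B (Fintype.card V) N b
  have hv : v ∈ holders (exec G ID B (grow (Fintype.card V) N) b) := by
    rw [holders_grow hID hB hN hLb]
    -- Everything is one cluster, which contains the source.
    exact ⟨s, s, hclu s v, by simp [holders, hbtok], .inl rfl⟩
  obtain ⟨t, ht⟩ := Option.ne_none_iff_exists'.1 hv
  have hp := hg.tok_pay (p := some m) (fun u t hu => by
    rw [hbtok] at hu
    split_ifs at hu
    rw [← Option.some_inj.1 hu]) v t ht
  change ((exec G ID B (grow (Fintype.card V) N) b v).tok.bind Token.pay) = some m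
  rw [ht]
  exact hp

end Correctness

/-! ### Length of the program and number of active rounds -/

section Complexity

theorem length_selection (n N j : ℕ) : (selection (P := P) n N j).length =
    j * (2 * (grow (P := P) n N).length + 2) + 1 := by
  induction j with
  | zero => simp [selection]
  | succ j ih =>
    simp only [selection, List.length_append, List.length_cons, List.length_nil, ih]
    ring

theorem length_spread (n N k : ℕ) :
    (spread (P := P) n N k).length = k * (grow (P := P) n N).length := by
  induction k with
  | zero => simp [spread]
  | succ k ih => rw [spread, List.length_append, ih]; ring

theorem length_merge (n N : ℕ) : (merge (P := P) n N).length =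
    Nat.size N * (4 * (grow (P := P) n N).length + 2) + 3 := by
  simp only [merge, List.length_append, List.length_cons, List.length_nil, length_selection,
    length_spread]
  ring

theorem length_mergeMany (n N k : ℕ) :
    (mergeMany (P := P) n N k).length = k * (merge (P := P) n N).length := by
  induction k with
  | zero => simp [mergeMany]
  | succ k ih => rw [mergeMany, List.length_append, ih]; ring

/-- `Nat.size n` merges, each with `4 * Nat.size N` growth steps of length at most `4 * n * N`,
dominate; the constant is generous. -/
theorem length_broadcast {n N : ℕ} (hn : 2 ≤ n) (hN : 2 ≤ N) :
    (broadcast (P := P) n N).length ≤ 60 * (n * N * Nat.size N * Nat.size n) := by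
  rw [broadcast, if_neg (by omega)]
  simp only [List.length_append, List.length_cons, List.length_nil, length_mergeMany,
    length_merge, length_grow]
  have hB : 1 ≤ Nat.size N := Nat.size_pos.2 (by omega)
  have hK : 1 ≤ Nat.size n := Nat.size_pos.2 (by omega)
  generalize Nat.size N = B at *
  generalize Nat.size n = K at *
  have h1 : 2 * n * (N + 1) + 1 ≤ 4 * (n * N) := by nlinarith
  have h2 : 1 ≤ n * N := by nlinarith
  generalize 2 * n * (N + 1) + 1 = g at *
  generalize n * N = x at *
  have h3 : 1 ≤ B * K := Nat.mul_pos hB hK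
  have h4 : B * (4 * g + 2) + 3 ≤ B * (21 * x) := by nlinarith
  calc K * (B * (4 * g + 2) + 3) + (g + (0 + 1) + 1)
      ≤ K * (B * (21 * x)) + 6 * x * (B * K) := by
        refine Nat.add_le_add (Nat.mul_le_mul_left _ h4) ?_
        nlinarith
    _ ≤ 60 * (x * B * K) := by nlinarith [Nat.zero_le (x * (B * K))]

variable (G : SimpleGraph V) (ID : V → ℕ) (B : ℕ)

theorem rounds_selection (n N j : ℕ) (st : V → Node P) (v : V) :
    rounds G ID B v (selection n N j) st ≤ 10 * j := by
  induction j with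
  | zero => exact le_rfl
  | succ j ih =>
    rw [selection, rounds_append, rounds_localStep, rounds_append, rounds_append,
      rounds_localStep]
    have h1 := rounds_grow G ID B n N
      (fun v => (exec G ID B (selection n N j) st v).seed fun q => q.mem && !q.clu.testBit j) v
    have h2 := rounds_grow G ID B n N (exec G ID B (grow n N)
      (fun v => (exec G ID B (selection n N j) st v).seed fun q => q.mem && !q.clu.testBit j)) v
    simp only [rounds]
    omega

theorem rounds_spread (n N k : ℕ) (st : V → Node P) (v : V) :
    rounds G ID B v (spread n N k) st ≤ 5 * k := by
  induction k with
  | zero => exact le_rfl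
  | succ k ih =>
    rw [spread, rounds_append]
    have := rounds_grow G ID B n N (exec G ID B (spread n N k) st) v
    omega

/-- Half of the bound is for the selection, half for the `2 * Nat.size N` steps of spreading. -/
theorem rounds_merge (n N : ℕ) (st : V → Node P) (v : V) :
    rounds G ID B v (merge n N) st ≤ 20 * Nat.size N := by
  rw [merge, rounds_append, rounds_localStep, rounds_append, rounds_localStep]
  have h1 := rounds_selection G ID B n N (Nat.size N) st v
  have h2 := rounds_spread G ID B n N (2 * Nat.size N)
    (fun v => (exec G ID B (selection n N (Nat.size N)) st v).seed Node.mem) v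
  simp only [rounds]
  omega

theorem rounds_mergeMany (n N k : ℕ) (st : V → Node P) (v : V) :
    rounds G ID B v (mergeMany n N k) st ≤ 20 * Nat.size N * k := by
  induction k with
  | zero => exact le_rfl
  | succ k ih =>
    rw [mergeMany, rounds_append, mul_add, mul_one]
    exact Nat.add_le_add ih (rounds_merge G ID B n N _ v)

theorem rounds_broadcast {n N : ℕ} (hn : 2 ≤ n) (hN : 2 ≤ N) (st : V → Node P) (v : V) :
    rounds G ID B v (broadcast n N) st ≤ 25 * (Nat.size N * Nat.size n) := by
  rw [broadcast, if_neg (by omega), rounds_append, rounds_localStep, rounds_append,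
    rounds_localStep]
  have h1 := rounds_mergeMany G ID B n N (Nat.size n) st v
  have h2 := rounds_grow G ID B n N
    (fun v => (exec G ID B (mergeMany n N (Nat.size n)) st v).load) v
  have h3 : 1 ≤ Nat.size N * Nat.size n :=
    Nat.mul_pos (Nat.size_pos.2 (by omega)) (Nat.size_pos.2 (by omega))
  rw [mul_assoc] at h1
  simp only [rounds]
  omega

theorem two_pow_size_sub_one_le {n : ℕ} (hn : 0 < n) : 2 ^ (Nat.size n - 1) ≤ n := by
  by_contra hc
  have := Nat.size_le.2 (not_le.1 hc)
  have := Nat.size_pos.2 hn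
  omega

/-- `Nat.size n` is at most `log₂ n + 1 ≤ 2 log₂ n`, and `2 / log 2 < 4`. -/
theorem size_le_log {n : ℕ} (hn : 2 ≤ n) : (Nat.size n : ℝ) ≤ 4 * Real.log n := by
  have h1 := two_pow_size_sub_one_le (show 0 < n by omega)
  have h2 : (((Nat.size n - 1 : ℕ) : ℝ)) * Real.log 2 ≤ Real.log n := by
    rw [← Real.log_pow]
    exact Real.log_le_log (by positivity) (by exact_mod_cast h1)
  have h3 : Real.log 2 ≤ Real.log n := Real.log_le_log two_pos (by exact_mod_cast hn)
  have h4 := Real.log_two_gt_d9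
  have h5 : Nat.size n = (Nat.size n - 1) + 1 := by
    have := Nat.size_pos.2 (show 0 < n by omega)
    omega
  rw [h5, Nat.cast_add, Nat.cast_one]
  nlinarith [Nat.cast_nonneg (α := ℝ) (Nat.size n - 1)]

end Complexity

end Radio

/-! ### The main theorem -/

theorem mainTheorem10 :
    ∃ (C : ℝ) (A : (P : Type) → Radio.Algorithm P),
      ∀ (P : Type) (n N : ℕ) (V : Type) [Fintype V] (G : SimpleGraph V) (ID : V → ℕ) (s : V)
        (m : P),
        Fintype.card V = n → G.Connected →
        Function.Injective ID → (∀ v, 1 ≤ ID v ∧ ID v ≤ N) →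
        (A P).BroadcastsWithin N G ID s m
          (C * (n * (N : ℝ) ^ 2 * Real.log N * Real.log n))
          (C * (Real.log N ^ 3 * Real.log n)) := by
  -- The energy bound dictates the constant: `6 * 25 * 4 ^ 3 * 2`. The time bound needs only `4 * 60
  -- * 4 ^ 2 = 3840`.
  refine ⟨19200, fun P => Radio.compile Radio.broadcast Radio.Node.init Radio.Node.pay, ?_⟩
  intro P n N V _ G ID s m hn hG hID hIDN
  subst hn
  have hN : ∀ v, ID v ≤ N := fun v => (hIDN v).2
  have hB : ∀ v, ID v < 2 ^ Nat.size N := fun v => (hN v).trans_lt (Nat.lt_size_self N)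
  -- For `n = 1` both bounds vanish because `log n = 0`, so the device must terminate at once; the
  -- program is then empty.
  by_cases hn : Fintype.card V ≤ 1
  · have h1 : Fintype.card V = 1 := le_antisymm hn (Fintype.card_pos_iff.2 ⟨s⟩)
    have hprog : Radio.broadcast (P := P) (Fintype.card V) N = [] := if_pos hn
    refine Radio.compile_broadcasts _ _ _ N G ID s m hN
      (Radio.exec_broadcast hID hB hN hG s m) (E := 0) ?_ ?_ ?_
    · intro v; rw [hprog]; exact le_rfl
    · rw [hprog, h1]; simp
    · rw [h1]; simp
  have hn2 : 2 ≤ Fintype.card V := by omega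
  have hcard : Fintype.card V ≤ N := by
    classical
    have : Finset.univ.image ID ⊆ Finset.Icc 1 N := fun x hx => by
      obtain ⟨v, _, rfl⟩ := Finset.mem_image.1 hx
      exact Finset.mem_Icc.2 (hIDN v)
    have := Finset.card_le_card this
    rwa [Finset.card_image_of_injective _ hID, Nat.card_Icc, Nat.add_sub_cancel] at this
  have hN2 : 2 ≤ N := hn2.trans hcard
  have hlogN := Radio.size_le_log hN2
  have hlogn := Radio.size_le_log hn2
  have hslots : 2 ^ (Nat.size N + 1) ≤ 4 * N := by
    have h0 := Nat.size_pos.2 (show 0 < N by omega)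
    have h1 := Radio.two_pow_size_sub_one_le (show 0 < N by omega)
    calc 2 ^ (Nat.size N + 1) = 4 * 2 ^ (Nat.size N - 1) := by
          rw [show Nat.size N + 1 = (Nat.size N - 1) + 2 by omega, pow_add]; ring
      _ ≤ 4 * N := Nat.mul_le_mul_left _ h1
  have hL : 0 ≤ Real.log N := Real.log_natCast_nonneg N
  have hl : 0 ≤ Real.log (Fintype.card V : ℝ) := Real.log_natCast_nonneg _
  refine Radio.compile_broadcasts _ _ _ N G ID s m hN (Radio.exec_broadcast hID hB hN hG s m)
    (fun v => Radio.rounds_broadcast G ID _ hn2 hN2 _ v) ?_ ?_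
  · have h1 := Nat.mul_le_mul hslots (Radio.length_broadcast (P := P) hn2 hN2)
    refine (Nat.cast_le.2 h1).trans ?_
    push_cast
    calc (4 * N * (60 * (Fintype.card V * N * Nat.size N * Nat.size (Fintype.card V))) : ℝ)
        = 240 * (Fintype.card V * (N : ℝ) ^ 2) *
            (Nat.size N * Nat.size (Fintype.card V)) := by ring
      _ ≤ 240 * (Fintype.card V * (N : ℝ) ^ 2) *
            ((4 * Real.log N) * (4 * Real.log (Fintype.card V))) := by gcongr
      _ = 3840 * (Fintype.card V * (N : ℝ) ^ 2 * Real.log N * Real.log (Fintype.card V)) := by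
        ring
      _ ≤ _ := by
        have : 0 ≤ Fintype.card V * (N : ℝ) ^ 2 * Real.log N * Real.log (Fintype.card V) := by
          positivity
        linarith
  · have h0 : 1 ≤ Nat.size N := Nat.size_pos.2 (by omega)
    have h1 : 2 * Nat.size N + 4 ≤ 6 * Nat.size N := by omega
    refine (Nat.cast_le.2 (Nat.mul_le_mul_right _ h1)).trans ?_
    push_cast
    -- Used only to weaken the `log² N` obtained to the `log³ N` claimed.
    have h2 : (1 : ℝ) ≤ 2 * Real.log N := by
      have h3 : Real.log 2 ≤ Real.log N := Real.log_le_log two_pos (by exact_mod_cast hN2)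
      have h4 := Real.log_two_gt_d9
      linarith
    calc (6 * Nat.size N * (25 * (Nat.size N * Nat.size (Fintype.card V))) : ℝ)
        = 150 * (Nat.size N * Nat.size N * Nat.size (Fintype.card V)) := by ring
      _ ≤ 150 * ((4 * Real.log N) * (4 * Real.log N) * (4 * Real.log (Fintype.card V))) := by
        gcongr
      _ = 9600 * (Real.log N ^ 2 * Real.log (Fintype.card V)) * 1 := by ring
      _ ≤ 9600 * (Real.log N ^ 2 * Real.log (Fintype.card V)) * (2 * Real.log N) := by
        gcongr
      _ = 19200 * (Real.log N ^ 3 * Real.log (Fintype.card V)) := by ring
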